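/- For a finite group $G$ let $\Theta_G(x_g) := \det\left(x_{gh^{-1}}\right)_{g,h\in G} \in \mathbb{Z}[x_g \mid g \in G]$ be its group determinant, and let $S(G) := \{\Theta_G(x_g) \mid x_g \in \mathbb{Z} \text{ for all } g \in G\}$ be the set of its values at integers. Let $\mathrm{C}_n$ denote the cyclic group of order $n$, and let $$A := \{(8k-3)(8l-3) \mid k, l \in \mathbb{Z},\ k \equiv l \pmod 2\}.$$ Then $A \subsetneq \{16m-7 \mid m \in \mathbb{Z}\}$, and \begin{align*} S(\mathrm{C}_8 \times \mathrm{C}_2) &= \{16m+1,\ m',\ 2^{10}(2m+1),\ 2^{12}m \mid m \in \mathbb{Z},\ m' \in A\} \\ &\quad \cup \{2^{11}p(2m+1) \mid p = a^2+b^2 \equiv 1 \ (\mathrm{mod}\ 8),\ a+b \equiv \pm 3 \ (\mathrm{mod}\ 8),\ a, b, m \in \mathbb{Z}\} \\ &\quad \cup \{2^{11}p(2m+1) \mid p \equiv -3 \ (\mathrm{mod}\ 8),\ m \in \mathbb{Z}\} \\ &\quad \cup \{2^{11}p^2(2m+1) \mid p \equiv 3 \ (\mathrm{mod}\ 8),\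 m \in \mathbb{Z}\}, \end{align*} where $p$ denotes a (positive) prime number. -/

import Mathlib

/-- The group matrix `(x_{g h⁻¹})_{g, h ∈ G}` of a finite group `G`, with entries in a ring `R`. -/
def groupMatrix {G R : Type*} [Group G] (x : G → R) : Matrix G G R :=
  Matrix.of fun g h => x (g * h⁻¹)

/-- The group determinant `Θ_G` as a polynomial with integer coefficients
in the indeterminates `x_g`, `g ∈ G`. -/
noncomputable def groupDeterminant (G : Type*) [Group G] [Fintype G] [DecidableEq G] :
    MvPolynomial G ℤ :=
  (groupMatrix fun g : G => (MvPolynomial.X g : MvPolynomial G ℤ)).det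

/-- `S(G)`: the set of all values of the group determinant of `G` at integers. -/
def integerGroupDeterminants (G : Type*) [Group G] [Fintype G] [DecidableEq G] : Set ℤ :=
  {n | ∃ x : G → ℤ, MvPolynomial.eval x (groupDeterminant G) = n}

/-- The value of the group determinant at `x` is the determinant of the group matrix of `x`. -/
theorem eval_groupDeterminant {G : Type*} [Group G] [Fintype G] [DecidableEq G] (x : G → ℤ) :
    MvPolynomial.eval x (groupDeterminant G) = (groupMatrix x).det := by
  unfold groupDeterminant
  rw [RingHom.map_det]
  congr 1
  ext g h
  simp [groupMatrix]

/-- The cyclic group `C_n = {0̄, 1̄, …, (n-1)‾}` of order `n`, written multiplicatively. -/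
abbrev CyclicGroup (n : ℕ) : Type := Multiplicative (ZMod n)

/-- The set `A` of products `(8k - 3)(8l - 3)` with `k ≡ l (mod 2)`. -/
def setA : Set ℤ :=
  {n | ∃ k l : ℤ, k ≡ l [ZMOD 2] ∧ n = (8 * k - 3) * (8 * l - 3)}

/-!
The group determinant of `C₈ × C₂` at `x` factors as `D(u) D(v)`, where `D` is the group determinant of
`C₈` and `u`, `v` are the sum and the difference of the two halves of `x`. Thus `S(C₈ × C₂)` is the set
of all `D(u) D(v)` with `u ≡ v` modulo `2` (`mem_integerGroupDeterminants_cyclicProd_iff`). With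
`u(x) = ∑ uᵢ xⁱ` and `ζ` a primitive eighth root of unity, `D(u)` is the product of `u(1) u(-1)`, of the
norm of `u(i) ∈ ℤ[i]` and of the norm of `u(ζ) ∈ ℤ[ζ]`. Put `pᵢ = uᵢ + uᵢ₊₄` and `rᵢ = uᵢ - uᵢ₊₄`, so that
`u(±1)` and `u(i)` depend on the `pᵢ` and `u(ζ)` on the `rᵢ`.

Odd values: for odd `D(u)` the residue of `D(u)` modulo `16` depends on `u` modulo `2` only
(`circulantDet8_modEq_of_odd`). Hence `D(u) ≡ D(v)` modulo `16`, and the product is `1` modulo `16` if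
`D(u) ≡ ±1` modulo `8`, and an element of `A` otherwise.

Even values: if the sums of the `uᵢ` with even and with odd index are both even, then `64` divides `D(u)`
and `D(v)`. If they are both odd, then `D(u) = 32 e N(a + b i) N(c + d i)` with odd norms, where
`u(1) u(-1) = 8 e`. The decisive point is that the parity of `e` is determined by `u` modulo `2` as soon
as `a + b i` and `c + d i` are semiprimary, that is, one of the coordinates is divisible by `4` and the sum
of the coordinates is `±1` modulo `8` (`exists_circulantDet8_eq`). So if the numbers attached to `u` and
`v` are all semiprimary, the product of the two factors `e` is odd or divisible by `4`, and the value is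
not `2 ^ 11` times an odd number. Since semiprimary numbers are closed under multiplication, a
number that is not semiprimary has a Gaussian prime factor that is not semiprimary, and the norms of
those primes are the prime powers of the last three families (`hasExceptionalPrime_sq_add_sq`).

Conversely, most values come from explicit vectors, in which a multiple of the constant vector provides
the free linear factor. For `p ≡ 5` modulo `8` the prime is put into the norm of `u(i)`. For the primes
`p ≡ 1` and `p ≡ 3` modulo `8` it has to be put into the norm of `u(ζ)`, so `p` or `p ^ 2` must be a norm from
`ℤ[ζ]`; that is so because `ℤ[ζ]` is Euclidean (`EighthCyclotomicInt.exists_cyclotomicNorm8_eq_prime`,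
`EighthCyclotomicInt.exists_cyclotomicNorm8_eq_prime_sq`, `two_pow_eleven_mul_cyclotomicNorm8_mem`).
-/

/-! ### The determinant of the group matrix -/

/-- The determinant of the circulant matrix of `(p₀, p₁, p₂, p₃)`, that is the product of
`p(1) p(-1)` and of the norm of `p(i)`. -/
def circulantDet4 (p₀ p₁ p₂ p₃ : ℤ) : ℤ :=
  ((p₀ + p₂) ^ 2 - (p₁ + p₃) ^ 2) * ((p₀ - p₂) ^ 2 + (p₁ - p₃) ^ 2)

/-- The norm to `ℤ` of `r₀ + r₁ ζ + r₂ ζ² + r₃ ζ³`, where `ζ` is a primitive eighth root of unity.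
It is written as the norm of the Gaussian integer that is its relative norm. -/
def cyclotomicNorm8 (r₀ r₁ r₂ r₃ : ℤ) : ℤ :=
  (r₀ ^ 2 - r₂ ^ 2 + 2 * (r₁ * r₃)) ^ 2 + (2 * (r₀ * r₂) - r₁ ^ 2 + r₃ ^ 2) ^ 2

/-- The group determinant of `C₈` at `u`, in factored form. -/
def circulantDet8 (u : Fin 8 → ℤ) : ℤ :=
  circulantDet4 (u 0 + u 4) (u 1 + u 5) (u 2 + u 6) (u 3 + u 7) *
    cyclotomicNorm8 (u 0 - u 4) (u 1 - u 5) (u 2 - u 6) (u 3 - u 7)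

theorem Matrix.det_fromBlocks_symm_circulant {n R : Type*} [Fintype n] [DecidableEq n] [CommRing R]
    (A B : Matrix n n R) : (fromBlocks A B B A).det = (A + B).det * (A - B).det := by
  have h : fromBlocks 1 1 0 1 * fromBlocks A B B A * fromBlocks 1 (-1) 0 1 =
      fromBlocks (A + B) 0 B (A - B) := by
    rw [fromBlocks_multiply, fromBlocks_multiply]
    congr 1 <;> simp <;> abel
  have h' := congrArg Matrix.det h
  rw [det_mul, det_mul, det_fromBlocks_zero₂₁, det_fromBlocks_zero₂₁, det_fromBlocks_zero₁₂] at h'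
  simpa using h'

theorem det_circulant4 (p₀ p₁ p₂ p₃ : ℤ) :
    (!![p₀, p₃, p₂, p₁; p₁, p₀, p₃, p₂; p₂, p₁, p₀, p₃; p₃, p₂, p₁, p₀]).det =
      circulantDet4 p₀ p₁ p₂ p₃ := by
  simp [Matrix.det_succ_row_zero, Fin.sum_univ_succ, Fin.succAbove, circulantDet4]
  ring

theorem det_skewCirculant4 (r₀ r₁ r₂ r₃ : ℤ) :
    (!![r₀, -r₃, -r₂, -r₁; r₁, r₀, -r₃, -r₂; r₂, r₁, r₀, -r₃; r₃, r₂, r₁, r₀]).det =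
      cyclotomicNorm8 r₀ r₁ r₂ r₃ := by
  simp [Matrix.det_succ_row_zero, Fin.sum_univ_succ, Fin.succAbove, cyclotomicNorm8]
  ring

/-- The enumeration of `C₈` by two blocks of four elements, the second one shifted by `4`. -/
def cyclicEightEnum : Fin 4 ⊕ Fin 4 → ZMod 8 :=
  Sum.elim (fun i => (i.val : ZMod 8)) (fun i => (i.val : ZMod 8) + 4)

theorem det_sub_circulant (u : Fin 8 → ℤ) :
    (Matrix.of fun i j : Fin 4 ⊕ Fin 4 => u (cyclicEightEnum i - cyclicEightEnum j)).det =
      circulantDet8 u := by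
  have h : (Matrix.of fun i j : Fin 4 ⊕ Fin 4 => u (cyclicEightEnum i - cyclicEightEnum j)) =
      Matrix.fromBlocks
        (!![u 0, u 7, u 6, u 5; u 1, u 0, u 7, u 6; u 2, u 1, u 0, u 7; u 3, u 2, u 1, u 0])
        (!![u 4, u 3, u 2, u 1; u 5, u 4, u 3, u 2; u 6, u 5, u 4, u 3; u 7, u 6, u 5, u 4])
        (!![u 4, u 3, u 2, u 1; u 5, u 4, u 3, u 2; u 6, u 5, u 4, u 3; u 7, u 6, u 5, u 4])
        (!![u 0, u 7, u 6, u 5; u 1, u 0, u 7, u 6; u 2, u 1, u 0, u 7; u 3, u 2, u 1, u 0]) := by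
    ext i j
    rcases i with i | i <;> rcases j with j | j <;> fin_cases i <;> fin_cases j <;> rfl
  rw [h, Matrix.det_fromBlocks_symm_circulant]
  unfold circulantDet8
  rw [← det_circulant4, ← det_skewCirculant4]
  congr 2 <;> ext i j <;> fin_cases i <;> fin_cases j <;> simp <;> ring

/-- The enumeration of `C₈ × C₂` by its two cosets modulo `C₈`. -/
def cyclicProdEnum : (Fin 4 ⊕ Fin 4) ⊕ (Fin 4 ⊕ Fin 4) → CyclicGroup 8 × CyclicGroup 2 :=
  Sum.elim (fun i => (Multiplicative.ofAdd (cyclicEightEnum i), Multiplicative.ofAdd 0))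
    (fun i => (Multiplicative.ofAdd (cyclicEightEnum i), Multiplicative.ofAdd 1))

theorem cyclicProdEnum_bijective : Function.Bijective cyclicProdEnum := by
  decide

theorem det_groupMatrix_cyclicProd (x : CyclicGroup 8 × CyclicGroup 2 → ℤ) :
    (groupMatrix x).det =
      circulantDet8 (fun i : ZMod 8 => x (Multiplicative.ofAdd i, Multiplicative.ofAdd 0) +
        x (Multiplicative.ofAdd i, Multiplicative.ofAdd 1)) *
      circulantDet8 (fun i : ZMod 8 => x (Multiplicative.ofAdd i, Multiplicative.ofAdd 0) -
        x (Multiplicative.ofAdd i, Multiplicative.ofAdd 1)) := by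
  rw [← Matrix.det_submatrix_equiv_self (Equiv.ofBijective _ cyclicProdEnum_bijective)]
  have h : (groupMatrix x).submatrix (Equiv.ofBijective _ cyclicProdEnum_bijective)
      (Equiv.ofBijective _ cyclicProdEnum_bijective) =
      Matrix.fromBlocks
        (Matrix.of fun i j => x (Multiplicative.ofAdd (cyclicEightEnum i - cyclicEightEnum j),
          Multiplicative.ofAdd 0))
        (Matrix.of fun i j => x (Multiplicative.ofAdd (cyclicEightEnum i - cyclicEightEnum j),
          Multiplicative.ofAdd 1))
        (Matrix.of fun i j => x (Multiplicative.ofAdd (cyclicEightEnum i - cyclicEightEnum j),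
          Multiplicative.ofAdd 1))
        (Matrix.of fun i j => x (Multiplicative.ofAdd (cyclicEightEnum i - cyclicEightEnum j),
          Multiplicative.ofAdd 0)) := by
    ext i j
    have h₀₀ : Multiplicative.ofAdd (0 : ZMod 2) * (Multiplicative.ofAdd 0)⁻¹ =
      Multiplicative.ofAdd 0 := by decide
    have h₀₁ : Multiplicative.ofAdd (0 : ZMod 2) * (Multiplicative.ofAdd 1)⁻¹ =
      Multiplicative.ofAdd 1 := by decide
    have h₁₀ : Multiplicative.ofAdd (1 : ZMod 2) * (Multiplicative.ofAdd 0)⁻¹ =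
      Multiplicative.ofAdd 1 := by decide
    have h₁₁ : Multiplicative.ofAdd (1 : ZMod 2) * (Multiplicative.ofAdd 1)⁻¹ =
      Multiplicative.ofAdd 0 := by decide
    rcases i with i | i <;> rcases j with j | j <;>
      simp only [Matrix.submatrix_apply, Equiv.ofBijective_apply, groupMatrix, Matrix.of_apply,
        cyclicProdEnum, Sum.elim_inl, Sum.elim_inr, Matrix.fromBlocks_apply₁₁,
        Matrix.fromBlocks_apply₁₂, Matrix.fromBlocks_apply₂₁, Matrix.fromBlocks_apply₂₂,
        Prod.inv_mk, Prod.mk_mul_mk, ofAdd_sub, div_eq_mul_inv, h₀₀, h₀₁, h₁₀, h₁₁]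
  rw [h, Matrix.det_fromBlocks_symm_circulant]
  exact congrArg₂ (· * ·)
    (det_sub_circulant fun i : ZMod 8 => x (Multiplicative.ofAdd i, Multiplicative.ofAdd 0) +
      x (Multiplicative.ofAdd i, Multiplicative.ofAdd 1))
    (det_sub_circulant fun i : ZMod 8 => x (Multiplicative.ofAdd i, Multiplicative.ofAdd 0) -
      x (Multiplicative.ofAdd i, Multiplicative.ofAdd 1))

/-- The integer group determinants of `C₈ × C₂` are the products of two group determinants of `C₈`
at integer vectors that are congruent modulo `2`. -/
theorem mem_integerGroupDeterminants_cyclicProd_iff (n : ℤ) :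
    n ∈ integerGroupDeterminants (CyclicGroup 8 × CyclicGroup 2) ↔
      ∃ u v : Fin 8 → ℤ, (∀ i, u i ≡ v i [ZMOD 2]) ∧ n = circulantDet8 u * circulantDet8 v := by
  simp only [integerGroupDeterminants, Set.mem_ofPred_eq, eval_groupDeterminant,
    det_groupMatrix_cyclicProd]
  constructor
  · rintro ⟨x, rfl⟩
    refine ⟨_, _, fun i => ?_, rfl⟩
    rw [Int.modEq_iff_dvd]
    exact ⟨-x (Multiplicative.ofAdd (i : ZMod 8), Multiplicative.ofAdd 1), by ring⟩
  · rintro ⟨u, v, h, rfl⟩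
    choose w hw using fun i => Int.modEq_iff_dvd.mp (h i)
    refine ⟨fun g => if g.2 = Multiplicative.ofAdd 0 then u (g.1.toAdd : ZMod 8) + w g.1.toAdd
      else - w g.1.toAdd, ?_⟩
    have h₁ : (Multiplicative.ofAdd (1 : ZMod 2)) ≠ Multiplicative.ofAdd 0 := by decide
    congr 2
    · funext i
      simp only [if_true, if_neg h₁, toAdd_ofAdd]
      ring
    · funext i
      simp only [if_true, if_neg h₁, toAdd_ofAdd]
      linarith [hw i]

/-! ### Odd values -/

theorem exists_sq_add_self_eq_two_mul (n : ℤ) : ∃ k, n ^ 2 + n = 2 * k := by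
  obtain ⟨k, hk⟩ := Int.even_mul_succ_self n
  exact ⟨k, by linarith⟩

theorem circulantDet4_modEq {p₀ p₁ p₂ p₃ : ℤ} (h₀ : Odd (p₀ + p₂)) (h₁ : Even (p₁ + p₃)) :
    circulantDet4 p₀ p₁ p₂ p₃ ≡ 1 + 4 * (p₀ * p₂ - p₁ * p₃) [ZMOD 16] := by
  apply Int.ModEq.symm
  rw [Int.modEq_iff_dvd]
  unfold circulantDet4
  rcases Int.even_or_odd' p₀ with ⟨a, rfl | rfl⟩ <;>
  rcases Int.even_or_odd' p₁ with ⟨b, rfl | rfl⟩ <;>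
  rcases Int.even_or_odd' p₂ with ⟨c, rfl | rfl⟩ <;>
  rcases Int.even_or_odd' p₃ with ⟨d, rfl | rfl⟩ <;>
  first
  | (exfalso; obtain ⟨x, hx⟩ := h₀; obtain ⟨y, hy⟩ := h₁; omega)
  | skip
  all_goals
    obtain ⟨k, hk⟩ := exists_sq_add_self_eq_two_mul a
    obtain ⟨l, hl⟩ := exists_sq_add_self_eq_two_mul b
    obtain ⟨m, hm⟩ := exists_sq_add_self_eq_two_mul c
    obtain ⟨n, hn⟩ := exists_sq_add_self_eq_two_mul d
    ring_nf at hk hl hm hn ⊢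
    omega

theorem cyclotomicNorm8_modEq {r₀ r₁ r₂ r₃ : ℤ} (h₀ : Odd (r₀ + r₂)) (h₁ : Even (r₁ + r₃)) :
    cyclotomicNorm8 r₀ r₁ r₂ r₃ ≡
      1 - 4 * (r₀ * r₂ - r₁ * r₃) + 4 * r₁ ^ 2 * (3 + 2 * r₀) [ZMOD 16] := by
  apply Int.ModEq.symm
  rw [Int.modEq_iff_dvd]
  unfold cyclotomicNorm8
  rcases Int.even_or_odd' r₀ with ⟨a, rfl | rfl⟩ <;>
  rcases Int.even_or_odd' r₁ with ⟨b, rfl | rfl⟩ <;>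
  rcases Int.even_or_odd' r₂ with ⟨c, rfl | rfl⟩ <;>
  rcases Int.even_or_odd' r₃ with ⟨d, rfl | rfl⟩ <;>
  first
  | (exfalso; obtain ⟨x, hx⟩ := h₀; obtain ⟨y, hy⟩ := h₁; omega)
  | skip
  all_goals
    obtain ⟨k, hk⟩ := exists_sq_add_self_eq_two_mul a
    obtain ⟨l, hl⟩ := exists_sq_add_self_eq_two_mul b
    obtain ⟨m, hm⟩ := exists_sq_add_self_eq_two_mul c
    obtain ⟨n, hn⟩ := exists_sq_add_self_eq_two_mul d
    ring_nf at hk hl hm hn ⊢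
    omega

/-- The coefficient of `2` in `p₀ p₂ - p₁ p₃` modulo `4`, where `pᵢ = uᵢ + uᵢ₊₄` is expanded
around `rᵢ = uᵢ - uᵢ₊₄`; its parity depends on `u` modulo `2` only. -/
def crossTerm (u : Fin 8 → ℤ) : ℤ :=
  u 4 * (u 2 - u 6) + u 6 * (u 0 - u 4) + u 5 * (u 3 - u 7) + u 7 * (u 1 - u 5)

theorem crossTerm_modEq {u v : Fin 8 → ℤ} (h : ∀ i, u i ≡ v i [ZMOD 2]) :
    crossTerm u ≡ crossTerm v [ZMOD 2] := by
  unfold crossTerm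
  gcongr <;> apply h

theorem sum_mul_sub_sum_mul_modEq (u : Fin 8 → ℤ) :
    (u 0 + u 4) * (u 2 + u 6) - (u 1 + u 5) * (u 3 + u 7) ≡
      (u 0 - u 4) * (u 2 - u 6) - (u 1 - u 5) * (u 3 - u 7) + 2 * crossTerm u [ZMOD 4] := by
  apply Int.ModEq.symm
  rw [Int.modEq_iff_dvd]
  exact ⟨u 4 * u 6 - u 5 * u 7 - u 5 * (u 3 - u 7) - u 7 * (u 1 - u 5), by
    unfold crossTerm; ring⟩

theorem circulantDet8_modEq_of_odd_even {u : Fin 8 → ℤ} (h₀ : Odd (u 0 + u 4 + (u 2 + u 6)))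
    (h₁ : Even (u 1 + u 5 + (u 3 + u 7))) :
    circulantDet8 u ≡
      1 + 8 * crossTerm u + 4 * ((u 1 + u 5) ^ 2 * (3 + 2 * (u 0 + u 4))) [ZMOD 16] := by
  have h₂ : Odd (u 0 - u 4 + (u 2 - u 6)) := by
    obtain ⟨k, hk⟩ := h₀; exact ⟨k - u 4 - u 6, by linarith⟩
  have h₃ : Even (u 1 - u 5 + (u 3 - u 7)) := by
    obtain ⟨k, hk⟩ := h₁; exact ⟨k - u 5 - u 7, by linarith⟩
  obtain ⟨x, hx⟩ := (circulantDet4_modEq h₀ h₁).dvd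
  obtain ⟨y, hy⟩ := (cyclotomicNorm8_modEq h₂ h₃).dvd
  obtain ⟨z, hz⟩ := (sum_mul_sub_sum_mul_modEq u).dvd
  -- `4 r₁² (3 + 2 r₀)` modulo `16` depends on the parities of `r₀` and `r₁` only
  have h₄ : ∃ w, (u 1 - u 5) ^ 2 * (3 + 2 * (u 0 - u 4)) -
      (u 1 + u 5) ^ 2 * (3 + 2 * (u 0 + u 4)) = 4 * w :=
    ⟨-(u 1 * u 5) * (3 + 2 * (u 0 - u 4)) - (u 1 + u 5) ^ 2 * u 4, by ring⟩
  obtain ⟨w, hw⟩ := h₄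
  unfold circulantDet8
  generalize circulantDet4 _ _ _ _ = D at *
  generalize cyclotomicNorm8 _ _ _ _ = N at *
  generalize (u 0 + u 4) * (u 2 + u 6) - (u 1 + u 5) * (u 3 + u 7) = Q at *
  generalize (u 0 - u 4) * (u 2 - u 6) - (u 1 - u 5) * (u 3 - u 7) = R at *
  have e : 4 * (u 1 - u 5) ^ 2 * (3 + 2 * (u 0 - u 4)) =
    4 * ((u 1 + u 5) ^ 2 * (3 + 2 * (u 0 + u 4)) + 4 * w) := by linear_combination 4 * hw
  rw [e] at hy
  generalize (u 1 + u 5) ^ 2 * (3 + 2 * (u 0 + u 4)) = K at *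
  generalize crossTerm u = L at *
  obtain rfl : D = 1 + 4 * Q - 16 * x := by linarith
  obtain rfl : N = 1 - 4 * R + 4 * (K + 4 * w) - 16 * y := by linarith
  obtain rfl : Q = R + 2 * L - 4 * z := by linarith
  apply Int.ModEq.symm
  rw [Int.modEq_iff_dvd]
  ring_nf
  omega

/-- A cyclic shift multiplies `u(x)` by `x`, and the product of all eighth roots of unity is `-1`. -/
theorem circulantDet8_rotate (u : Fin 8 → ℤ) :
    circulantDet8 (fun i => u (i - 1)) = -circulantDet8 u := by
  have e : ∀ i : Fin 8, i - 1 = ![7, 0, 1, 2, 3, 4, 5, 6] i := by decide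
  simp only [circulantDet8, e, circulantDet4, cyclotomicNorm8]
  simp
  ring

/-- Up to a cyclic shift the sum of the `uᵢ` with even index is odd, and then the residue modulo `16`
is a function of `u` modulo `2`. -/
theorem circulantDet8_modEq_of_odd {u v : Fin 8 → ℤ} (h : ∀ i, u i ≡ v i [ZMOD 2])
    (hu : Odd (u 0 + u 4 + (u 2 + u 6) + (u 1 + u 5 + (u 3 + u 7)))) :
    circulantDet8 u ≡ circulantDet8 v [ZMOD 16] := by
  have key : ∀ u v : Fin 8 → ℤ, (∀ i, u i ≡ v i [ZMOD 2]) → Odd (u 0 + u 4 + (u 2 + u 6)) →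
      Even (u 1 + u 5 + (u 3 + u 7)) → circulantDet8 u ≡ circulantDet8 v [ZMOD 16] := by
    intro u v h h₀ h₁
    have h₀' : Odd (v 0 + v 4 + (v 2 + v 6)) := by
      have := h 0; have := h 2; have := h 4; have := h 6
      rw [Int.odd_iff] at *; simp only [Int.ModEq] at *; omega
    have h₁' : Even (v 1 + v 5 + (v 3 + v 7)) := by
      have := h 1; have := h 3; have := h 5; have := h 7
      rw [Int.even_iff] at *; simp only [Int.ModEq] at *; omega
    refine (circulantDet8_modEq_of_odd_even h₀ h₁).trans
      (Int.ModEq.trans ?_ (circulantDet8_modEq_of_odd_even h₀' h₁').symm)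
    obtain ⟨x, hx⟩ := (crossTerm_modEq h).dvd
    obtain ⟨a, ha⟩ := ((h 0).add (h 4)).dvd
    obtain ⟨b, hb⟩ := ((h 1).add (h 5)).dvd
    rw [Int.modEq_iff_dvd]
    rw [show v 0 + v 4 = u 0 + u 4 + 2 * a by linarith,
      show v 1 + v 5 = u 1 + u 5 + 2 * b by linarith,
      show crossTerm v = crossTerm u + 2 * x by linarith]
    exact ⟨x + ((u 1 + u 5) * b + b ^ 2) * (3 + 2 * (u 0 + u 4 + 2 * a)) + (u 1 + u 5) ^ 2 * a, by
      ring⟩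
  by_cases h₁ : Even (u 1 + u 5 + (u 3 + u 7))
  · exact key u v h (by rw [Int.even_iff] at h₁; rw [Int.odd_iff] at *; omega) h₁
  · have := key (fun i => u (i - 1)) (fun i => v (i - 1)) (fun i => h _)
      (by
        change Odd (u 7 + u 3 + (u 1 + u 5))
        rw [Int.even_iff] at h₁; rw [Int.odd_iff] at *; omega)
      (by
        change Even (u 0 + u 4 + (u 2 + u 6))
        rw [Int.even_iff] at *; rw [Int.odd_iff] at *; omega)
    rw [circulantDet8_rotate, circulantDet8_rotate] at this
    simpa using this.neg

theorem odd_circulantDet8 {u : Fin 8 → ℤ}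
    (hu : Odd (u 0 + u 4 + (u 2 + u 6) + (u 1 + u 5 + (u 3 + u 7)))) : Odd (circulantDet8 u) := by
  have key : ∀ u : Fin 8 → ℤ, Odd (u 0 + u 4 + (u 2 + u 6)) →
      Even (u 1 + u 5 + (u 3 + u 7)) → Odd (circulantDet8 u) := by
    intro u h₀ h₁
    obtain ⟨x, hx⟩ := (circulantDet8_modEq_of_odd_even h₀ h₁).dvd
    rw [Int.odd_iff]
    omega
  by_cases h₁ : Even (u 1 + u 5 + (u 3 + u 7))
  · exact key u (by rw [Int.even_iff] at h₁; rw [Int.odd_iff] at *; omega) h₁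
  · have := key (fun i => u (i - 1))
      (by
        change Odd (u 7 + u 3 + (u 1 + u 5))
        rw [Int.even_iff] at h₁; rw [Int.odd_iff] at *; omega)
      (by
        change Even (u 0 + u 4 + (u 2 + u 6))
        rw [Int.even_iff] at *; rw [Int.odd_iff] at *; omega)
    rw [circulantDet8_rotate] at this
    simpa using this

theorem mul_modEq_one_or_mem_setA {x y : ℤ} (hx : Odd x) (h : x ≡ y [ZMOD 16]) :
    (∃ m, x * y = 16 * m + 1) ∨ x * y ∈ setA := by
  obtain ⟨t, ht⟩ := h.dvd
  obtain rfl : y = x + 16 * t := by linarith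
  have : x % 8 = 1 ∨ x % 8 = 7 ∨ x % 8 = 3 ∨ x % 8 = 5 := by
    rw [Int.odd_iff] at hx; omega
  rcases this with h | h | h | h
  · obtain ⟨k, rfl⟩ : ∃ k, x = 8 * k + 1 := ⟨x / 8, by omega⟩
    exact Or.inl ⟨k + 4 * k ^ 2 + (8 * k + 1) * t, by ring⟩
  · obtain ⟨k, rfl⟩ : ∃ k, x = 8 * k - 1 := ⟨x / 8 + 1, by omega⟩
    exact Or.inl ⟨-k + 4 * k ^ 2 + (8 * k - 1) * t, by ring⟩
  · obtain ⟨k, rfl⟩ : ∃ k, x = 8 * k + 3 := ⟨x / 8, by omega⟩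
    exact Or.inr ⟨-k, -k - 2 * t, by rw [Int.modEq_iff_dvd]; exact ⟨-t, by ring⟩, by ring⟩
  · obtain ⟨k, rfl⟩ : ∃ k, x = 8 * k - 3 := ⟨x / 8 + 1, by omega⟩
    exact Or.inr ⟨k, k + 2 * t, by rw [Int.modEq_iff_dvd]; exact ⟨t, by ring⟩, by ring⟩

theorem setA_ssubset : setA ⊂ {n : ℤ | ∃ m : ℤ, n = 16 * m - 7} := by
  refine ⟨?_, fun h => ?_⟩
  · rintro _ ⟨k, l, h, rfl⟩
    obtain ⟨t, ht⟩ := h.dvd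
    obtain rfl : l = k + 2 * t := by linarith
    exact ⟨4 * k * (k + 2 * t) - 3 * (k + t) + 1, by ring⟩
  · -- `-7` has no divisor congruent to `5` modulo `8`
    obtain ⟨k, l, -, h⟩ := h (show (-7 : ℤ) ∈ {n : ℤ | ∃ m : ℤ, n = 16 * m - 7} from ⟨0, by norm_num⟩)
    have hd : (8 * k - 3) ∣ 7 := ⟨-(8 * l - 3), by linarith⟩
    have := Int.le_of_dvd (by norm_num) hd
    have := Int.le_of_dvd (by norm_num) (neg_dvd.mpr hd)
    have : k = 0 ∨ k = 1 := by omega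
    rcases this with rfl | rfl <;> omega

/-! ### Even values and the parity of `u(1) u(-1) / 8` -/

/-- The Gaussian integer `a + b i` is called semiprimary if one of `a`, `b` is divisible by `4` and
`a + b ≡ ±1` modulo `8`. This is invariant under units and conjugation; the semiprimary numbers are
closed under multiplication, and their norms are `1` modulo `8`. -/
def IsSemiprimary (a b : ℤ) : Prop :=
  (4 ∣ a ∨ 4 ∣ b) ∧ ((a + b) % 8 = 1 ∨ (a + b) % 8 = 7)

theorem sixtyFour_dvd_circulantDet8 {u : Fin 8 → ℤ} (h₀ : Even (u 0 + u 4 + (u 2 + u 6)))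
    (h₁ : Even (u 1 + u 5 + (u 3 + u 7))) : 64 ∣ circulantDet8 u := by
  obtain ⟨a, ha⟩ := h₀
  obtain ⟨b, hb⟩ := h₁
  have e₀ : u 0 = 2 * a - u 4 - (u 2 + u 6) := by linarith
  have e₁ : u 1 = 2 * b - u 5 - (u 3 + u 7) := by linarith
  have h₄ : 16 ∣ circulantDet4 (u 0 + u 4) (u 1 + u 5) (u 2 + u 6) (u 3 + u 7) := by
    rw [e₀, e₁]
    exact ⟨(a ^ 2 - b ^ 2) * ((a - (u 2 + u 6)) ^ 2 + (b - (u 3 + u 7)) ^ 2), by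
      unfold circulantDet4; ring⟩
  have h₈ : 4 ∣ cyclotomicNorm8 (u 0 - u 4) (u 1 - u 5) (u 2 - u 6) (u 3 - u 7) := by
    obtain ⟨x, hx⟩ : ∃ x, u 0 - u 4 = 2 * x + (u 2 - u 6) := ⟨a - u 4 - u 2, by linarith⟩
    obtain ⟨y, hy⟩ : ∃ y, u 1 - u 5 = 2 * y + (u 3 - u 7) := ⟨b - u 5 - u 3, by linarith⟩
    rw [hx, hy]
    exact ⟨(2 * x ^ 2 + 2 * x * (u 2 - u 6) + (2 * y + (u 3 - u 7)) * (u 3 - u 7)) ^ 2 +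
      ((2 * x + (u 2 - u 6)) * (u 2 - u 6) - 2 * y ^ 2 - 2 * y * (u 3 - u 7)) ^ 2, by
      unfold cyclotomicNorm8; ring⟩
  exact mul_dvd_mul h₄ h₈

/-- With `u(x) = ∑ uᵢ xⁱ`, here `u(1) u(-1) = 8 e`, while `u(i)` and the relative norm of `u(ζ)` to
`ℤ[i]` are `(1 + i)(a - b i)` and `(1 + i)(c - d i)`. If `a + b i` and `c + d i` are semiprimary, the
parity of `e` is a function of `u` modulo `2`. -/
theorem exists_circulantDet8_eq {u : Fin 8 → ℤ} (h₀ : Odd (u 0 + u 4 + (u 2 + u 6)))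
    (h₁ : Odd (u 1 + u 5 + (u 3 + u 7))) :
    ∃ e a b c d : ℤ, circulantDet8 u = 32 * (e * (a ^ 2 + b ^ 2) * (c ^ 2 + d ^ 2)) ∧
      Odd (a + b) ∧ Odd (c + d) ∧
      (IsSemiprimary a b → IsSemiprimary c d → e ≡ crossTerm u [ZMOD 2]) := by
  obtain ⟨z, hz⟩ := (sum_mul_sub_sum_mul_modEq u).dvd
  unfold circulantDet8 circulantDet4 cyclotomicNorm8
  have hp₀ : Odd (u 0 - u 4 + (u 2 - u 6)) := by
    obtain ⟨k, hk⟩ := h₀; exact ⟨k - u 4 - u 6, by linarith⟩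
  have hp₁ : Odd (u 1 - u 5 + (u 3 - u 7)) := by
    obtain ⟨k, hk⟩ := h₁; exact ⟨k - u 5 - u 7, by linarith⟩
  generalize crossTerm u = L at *
  generalize u 0 + u 4 = p₀ at *
  generalize u 1 + u 5 = p₁ at *
  generalize u 2 + u 6 = p₂ at *
  generalize u 3 + u 7 = p₃ at *
  generalize u 0 - u 4 = r₀ at *
  generalize u 1 - u 5 = r₁ at *
  generalize u 2 - u 6 = r₂ at *
  generalize u 3 - u 7 = r₃ at *
  obtain ⟨e, he⟩ : ∃ e, (p₀ + p₂) ^ 2 - (p₁ + p₃) ^ 2 = 8 * e := by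
    obtain ⟨x, hx⟩ := h₀
    obtain ⟨y, hy⟩ := h₁
    obtain ⟨k, hk⟩ := exists_sq_add_self_eq_two_mul x
    obtain ⟨l, hl⟩ := exists_sq_add_self_eq_two_mul y
    exact ⟨k - l, by rw [hx, hy]; linear_combination 4 * hk - 4 * hl⟩
  obtain ⟨a, b, ha, hb⟩ : ∃ a b, p₀ - p₂ = a + b ∧ p₁ - p₃ = a - b := by
    obtain ⟨x, hx⟩ := h₀
    obtain ⟨y, hy⟩ := h₁
    exact ⟨x + y + 1 - p₂ - p₃, x - y - p₂ + p₃, by linarith, by linarith⟩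
  obtain ⟨x, hx⟩ := hp₀
  obtain ⟨y, hy⟩ := hp₁
  have hX : Odd (r₀ ^ 2 - r₂ ^ 2 + 2 * (r₁ * r₃)) := by
    rw [show r₀ = 2 * x + 1 - r₂ by linarith]
    exact ⟨2 * x ^ 2 + 2 * x - 2 * x * r₂ - r₂ + r₁ * r₃, by ring⟩
  have hY : Odd (2 * (r₀ * r₂) - r₁ ^ 2 + r₃ ^ 2) := by
    rw [show r₁ = 2 * y + 1 - r₃ by linarith]
    exact ⟨r₀ * r₂ - 2 * y ^ 2 - 2 * y + 2 * y * r₃ + r₃ - 1, by ring⟩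
  obtain ⟨c, d, hc, hd⟩ : ∃ c d, r₀ ^ 2 - r₂ ^ 2 + 2 * (r₁ * r₃) = c + d ∧
      2 * (r₀ * r₂) - r₁ ^ 2 + r₃ ^ 2 = c - d := by
    obtain ⟨x, hx⟩ := hX
    obtain ⟨y, hy⟩ := hY
    exact ⟨x + y + 1, x - y, by linarith, by linarith⟩
  refine ⟨e, a, b, c, d, ?_, ?_, hc ▸ hX, ?_⟩
  · rw [ha, hb, hc, hd, he]; ring
  · rw [← ha]; obtain ⟨k, hk⟩ := h₀; exact ⟨k - p₂, by linarith⟩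
  · rintro ⟨hab, -⟩ ⟨-, hcd⟩
    rw [← hc] at hcd
    -- `c + d ≡ ±1` modulo `8` forces `r₀ r₂ ≡ r₁ r₃` modulo `4`
    have hr : ∃ w, r₀ * r₂ - r₁ * r₃ = 4 * w := by
      suffices 4 ∣ r₀ * r₂ - r₁ * r₃ from this
      rcases Int.even_or_odd' r₀ with ⟨a, rfl | rfl⟩ <;>
      rcases Int.even_or_odd' r₁ with ⟨b, rfl | rfl⟩ <;>
      rcases Int.even_or_odd' r₂ with ⟨c, rfl | rfl⟩ <;>
      rcases Int.even_or_odd' r₃ with ⟨d, rfl | rfl⟩ <;>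
      first
      | (exfalso; omega)
      | skip
      all_goals
        clear hX hY hc hd hz hx hy
        obtain ⟨k, hk⟩ := exists_sq_add_self_eq_two_mul a
        obtain ⟨l, hl⟩ := exists_sq_add_self_eq_two_mul b
        obtain ⟨m, hm⟩ := exists_sq_add_self_eq_two_mul c
        obtain ⟨n, hn⟩ := exists_sq_add_self_eq_two_mul d
        ring_nf at hk hl hm hn hcd ⊢
        omega
    obtain ⟨w, hw⟩ := hr
    obtain ⟨t, ht⟩ : ∃ t, a * b = 4 * t := by
      rcases hab with ⟨t, rfl⟩ | ⟨t, rfl⟩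
      exacts [⟨t * b, by ring⟩, ⟨a * t, by ring⟩]
    have h8 : 8 * e = 4 * (a * b) + 4 * (p₀ * p₂ - p₁ * p₃) := by
      rw [← he, show p₀ = a + b + p₂ by linarith, show p₁ = a - b + p₃ by linarith]; ring
    rw [Int.modEq_iff_dvd]
    omega

/-! ### Gaussian integers that are not semiprimary -/

/-- `q` divides `n`, to the second power if `q ≡ 3` modulo `8`, for a prime `q` that is the norm of
a Gaussian prime that is not semiprimary, or is itself such a Gaussian prime. -/
def HasExceptionalPrime (n : ℤ) : Prop :=
  ∃ q : ℕ, q.Prime ∧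
    ((∃ a b : ℤ, (q : ℤ) = a ^ 2 + b ^ 2 ∧ (q : ℤ) ≡ 1 [ZMOD 8] ∧
        (a + b ≡ 3 [ZMOD 8] ∨ a + b ≡ -3 [ZMOD 8]) ∧ (q : ℤ) ∣ n) ∨
      ((q : ℤ) ≡ -3 [ZMOD 8] ∧ (q : ℤ) ∣ n) ∨ ((q : ℤ) ≡ 3 [ZMOD 8] ∧ (q : ℤ) ^ 2 ∣ n))

theorem HasExceptionalPrime.mono {m n : ℤ} (h : HasExceptionalPrime m) (hmn : m ∣ n) :
    HasExceptionalPrime n := by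
  obtain ⟨q, hq, ⟨a, b, h₁, h₂, h₃, h₄⟩ | ⟨h₁, h₂⟩ | ⟨h₁, h₂⟩⟩ := h
  · exact ⟨q, hq, Or.inl ⟨a, b, h₁, h₂, h₃, h₄.trans hmn⟩⟩
  · exact ⟨q, hq, Or.inr (Or.inl ⟨h₁, h₂.trans hmn⟩)⟩
  · exact ⟨q, hq, Or.inr (Or.inr ⟨h₁, h₂.trans hmn⟩)⟩

theorem IsSemiprimary.mul {a b c d : ℤ} (h : IsSemiprimary a b) (h' : IsSemiprimary c d) :
    IsSemiprimary (a * c - b * d) (a * d + b * c) := by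
  obtain ⟨h₁, h₂⟩ := h
  obtain ⟨h₃, h₄⟩ := h'
  -- `a + b` is multiplicative up to sign modulo `8`
  have key : ∀ x k : ℤ, x = (a + b) * (c + d) + 8 * k ∨ x = -((a + b) * (c + d)) + 8 * k →
      x % 8 = 1 ∨ x % 8 = 7 := by
    intro x k hx
    have hm : ((a + b) * (c + d)) % 8 = 1 ∨ ((a + b) * (c + d)) % 8 = 7 := by
      rw [Int.mul_emod]
      rcases h₂ with h₂ | h₂ <;> rcases h₄ with h₄ | h₄ <;> rw [h₂, h₄] <;> decide
    generalize (a + b) * (c + d) = m at *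
    omega
  rcases h₁ with ⟨s, rfl⟩ | ⟨s, rfl⟩ <;> rcases h₃ with ⟨t, rfl⟩ | ⟨t, rfl⟩
  · exact ⟨Or.inr ⟨s * d + b * t, by ring⟩, key _ (4 * s * t + s * d + b * t) (Or.inr (by ring))⟩
  · exact ⟨Or.inl ⟨s * c - b * t, by ring⟩, key _ (-(b * t)) (Or.inl (by ring))⟩
  · exact ⟨Or.inl ⟨a * t - s * d, by ring⟩, key _ (-(s * d)) (Or.inl (by ring))⟩
  · exact ⟨Or.inr ⟨a * t + s * c, by ring⟩, key _ (-(4 * s * t)) (Or.inl (by ring))⟩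

theorem IsSemiprimary.conj {a b : ℤ} (h : IsSemiprimary a b) : IsSemiprimary a (-b) := by
  obtain ⟨h₁, h₂⟩ := h
  refine ⟨by simpa using h₁, ?_⟩
  omega

theorem exists_eq_mul_of_prime_dvd_sq_add_sq {q : ℕ} (hq : q.Prime) {a b c d : ℤ}
    (hcd : (q : ℤ) = c ^ 2 + d ^ 2) (hab : (q : ℤ) ∣ a ^ 2 + b ^ 2) :
    ∃ x y d' : ℤ, (d' = d ∨ d' = -d) ∧ a = c * x - d' * y ∧ b = c * y + d' * x := by
  have hq' : Prime (q : ℤ) := Nat.prime_iff_prime_int.mp hq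
  obtain ⟨n, hn⟩ := hab
  obtain ⟨d', hd', hdvd⟩ : ∃ d', (d' = d ∨ d' = -d) ∧ (q : ℤ) ∣ a * c + b * d' := by
    have : (q : ℤ) ∣ (a * c + b * d) * (a * c + b * -d) :=
      ⟨c ^ 2 * n - b ^ 2, by linear_combination c ^ 2 * hn + b ^ 2 * hcd⟩
    rcases hq'.dvd_or_dvd this with h | h
    exacts [⟨d, Or.inl rfl, h⟩, ⟨-d, Or.inr rfl, h⟩]
  have hcd' : (q : ℤ) = c ^ 2 + d' ^ 2 := by rcases hd' with rfl | rfl <;> linarith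
  obtain ⟨x, hx⟩ := hdvd
  obtain ⟨y, hy⟩ : (q : ℤ) ∣ b * c - a * d' := by
    refine hq'.dvd_of_dvd_pow (n := 2) ⟨q * n - q * x ^ 2, ?_⟩
    have : (b * c - a * d') ^ 2 = (a ^ 2 + b ^ 2) * (c ^ 2 + d' ^ 2) - (a * c + b * d') ^ 2 := by
      ring
    rw [this, hx, hn, ← hcd']
    ring
  refine ⟨x, y, d', hd', mul_left_cancel₀ hq'.ne_zero ?_, mul_left_cancel₀ hq'.ne_zero ?_⟩
  · linear_combination a * hcd' + c * hx - d' * hy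
  · linear_combination b * hcd' + c * hy + d' * hx

theorem Nat.Prime.dvd_of_dvd_sq_add_sq {q : ℕ} (hq : q.Prime) (h3 : q % 4 = 3) {a b : ℤ}
    (h : (q : ℤ) ∣ a ^ 2 + b ^ 2) : (q : ℤ) ∣ a ∧ (q : ℤ) ∣ b := by
  have := Fact.mk hq
  have h' : (a : ZMod q) ^ 2 + (b : ZMod q) ^ 2 = 0 := by
    have := (ZMod.intCast_zmod_eq_zero_iff_dvd _ q).mpr h
    exact_mod_cast this
  constructor <;> rw [← ZMod.intCast_zmod_eq_zero_iff_dvd] <;> by_contra hne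
  · exact ZMod.mod_four_ne_three_of_sq_eq_neg_sq' hne (x := (b : ZMod q)) (by linear_combination h') h3
  · exact ZMod.mod_four_ne_three_of_sq_eq_neg_sq' hne (x := (a : ZMod q)) (by linear_combination h') h3

theorem four_dvd_or_four_dvd_of_eq_sq_add_sq {n a b : ℤ} (h1 : n % 8 = 1) (h : n = a ^ 2 + b ^ 2) :
    (4 ∣ a ∨ 4 ∣ b) ∧ (a + b) % 2 = 1 := by
  have : ∀ x : ℤ, ∃ k, x ^ 2 = 8 * k ∧ x % 4 = 0 ∨ x ^ 2 = 8 * k + 4 ∧ x % 4 = 2 ∨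
      x ^ 2 = 8 * k + 1 ∧ x % 2 = 1 := by
    intro x
    rcases Int.even_or_odd' x with ⟨y, rfl | rfl⟩
    · rcases Int.even_or_odd' y with ⟨z, rfl | rfl⟩
      · exact ⟨2 * z ^ 2, Or.inl ⟨by ring, by omega⟩⟩
      · exact ⟨2 * z ^ 2 + 2 * z, Or.inr (Or.inl ⟨by ring, by omega⟩)⟩
    · obtain ⟨k, hk⟩ := exists_sq_add_self_eq_two_mul y
      exact ⟨k, Or.inr (Or.inr ⟨by linear_combination 4 * hk, by omega⟩)⟩
  obtain ⟨k, hk⟩ := this a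
  obtain ⟨l, hl⟩ := this b
  omega

/-- Since semiprimary numbers are closed under multiplication, a Gaussian integer that is not
semiprimary has a prime factor that is not semiprimary. -/
theorem hasExceptionalPrime_sq_add_sq {a b : ℤ} (hodd : Odd (a + b)) (h : ¬ IsSemiprimary a b) :
    HasExceptionalPrime (a ^ 2 + b ^ 2) := by
  induction hn : (a ^ 2 + b ^ 2).natAbs using Nat.strong_induction_on generalizing a b with
  | _ n ih =>
    subst hn
    have hodd2 : Odd (a ^ 2 + b ^ 2) := by
      obtain ⟨k, hk⟩ := hodd
      obtain rfl : a = 2 * k + 1 - b := by linarith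
      exact ⟨2 * k ^ 2 + b ^ 2 + 2 * k - 2 * k * b - b, by ring⟩
    have hpos : 0 < a ^ 2 + b ^ 2 := by
      rcases (add_nonneg (sq_nonneg a) (sq_nonneg b)).lt_or_eq with h | h
      · exact h
      · rw [← h] at hodd2; simp at hodd2
    have hne : (a ^ 2 + b ^ 2).natAbs ≠ 1 := by
      intro h1
      have h1' : a ^ 2 + b ^ 2 = 1 := by omega
      apply h
      have ha : -1 ≤ a ∧ a ≤ 1 := by constructor <;> nlinarith [sq_nonneg b]
      have hb : -1 ≤ b ∧ b ≤ 1 := by constructor <;> nlinarith [sq_nonneg a]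
      obtain ⟨k, hk⟩ := hodd
      unfold IsSemiprimary
      have : a = 0 ∨ b = 0 := by
        by_contra! hab
        have : a = 1 ∨ a = -1 := by omega
        have : b = 1 ∨ b = -1 := by omega
        omega
      omega
    obtain ⟨q, hq, hqn⟩ := Nat.exists_prime_and_dvd hne
    have hqd : (q : ℤ) ∣ a ^ 2 + b ^ 2 := Int.natCast_dvd.mpr hqn
    have hqodd : q % 2 = 1 := by
      rcases hq.eq_two_or_odd with rfl | h
      · obtain ⟨k, hk⟩ := hodd2
        obtain ⟨l, hl⟩ := hqd
        push_cast at hl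
        omega
      · exact h
    -- descent along a factorization `a + b i = (c + d i) (x + y i)` with `c + d i` semiprimary
    have step : ∀ c d x y : ℤ, a = c * x - d * y → b = c * y + d * x → 1 < c ^ 2 + d ^ 2 →
        IsSemiprimary c d → HasExceptionalPrime (a ^ 2 + b ^ 2) := by
      intro c d x y hx hy h1 hcd
      have e : a ^ 2 + b ^ 2 = (c ^ 2 + d ^ 2) * (x ^ 2 + y ^ 2) := by rw [hx, hy]; ring
      have hpos' : 0 < x ^ 2 + y ^ 2 := by
        rw [e] at hpos; exact pos_of_mul_pos_right hpos (by linarith)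
      refine (ih (x ^ 2 + y ^ 2).natAbs ?_ ?_ ?_ rfl).mono (e ▸ dvd_mul_left _ _)
      · zify
        rw [abs_of_pos hpos', abs_of_pos hpos, e]
        nlinarith
      · rw [e] at hodd2
        have := (Int.odd_mul.mp hodd2).2
        rw [Int.odd_add, Int.odd_pow' two_ne_zero, Int.even_pow' two_ne_zero] at this
        rwa [Int.odd_add]
      · intro hxy
        apply h
        have := hcd.mul hxy
        rw [hx, hy]
        exact this
    have hq8 : q % 8 = 1 ∨ q % 8 = 3 ∨ q % 8 = 5 ∨ q % 8 = 7 := by omega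
    rcases hq8 with hq8 | hq8 | hq8 | hq8
    · have := Fact.mk hq
      obtain ⟨c, d, hcd⟩ := Nat.Prime.sq_add_sq (p := q) (by omega)
      have hcd' : (q : ℤ) = (c : ℤ) ^ 2 + (d : ℤ) ^ 2 := by exact_mod_cast hcd.symm
      have h8 : (q : ℤ) % 8 = 1 := by omega
      obtain ⟨h4, h2⟩ := four_dvd_or_four_dvd_of_eq_sq_add_sq h8 hcd'
      by_cases hsp : IsSemiprimary c d
      · obtain ⟨x, y, d', hd', hx, hy⟩ := exists_eq_mul_of_prime_dvd_sq_add_sq hq hcd' hqd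
        have hd'' : (q : ℤ) = (c : ℤ) ^ 2 + d' ^ 2 := by rcases hd' with rfl | rfl <;> linarith
        refine step c d' x y hx hy ?_ ?_
        · rw [← hd'']; exact_mod_cast hq.one_lt
        · rcases hd' with rfl | rfl
          exacts [hsp, hsp.conj]
      · refine ⟨q, hq, Or.inl ⟨c, d, hcd', h8, ?_, hqd⟩⟩
        unfold IsSemiprimary at hsp
        simp only [Int.ModEq]
        omega
    · obtain ⟨⟨x, hx⟩, ⟨y, hy⟩⟩ := hq.dvd_of_dvd_sq_add_sq (by omega) hqd
      refine ⟨q, hq, Or.inr (Or.inr ⟨by simp only [Int.ModEq]; omega, x ^ 2 + y ^ 2, ?_⟩)⟩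
      rw [hx, hy]; ring
    · exact ⟨q, hq, Or.inr (Or.inl ⟨by simp only [Int.ModEq]; omega, hqd⟩)⟩
    · obtain ⟨⟨x, hx⟩, ⟨y, hy⟩⟩ := hq.dvd_of_dvd_sq_add_sq (by omega) hqd
      refine step q 0 x y (by linarith) (by linarith) ?_ ?_
      · have : 1 < (q : ℤ) := by exact_mod_cast hq.one_lt
        nlinarith
      · exact ⟨Or.inr (dvd_zero _), by omega⟩

/-- An even value is divisible by `2 ^ 10`; if it is `2 ^ 11` times an odd number, that number has
an exceptional prime. -/
theorem exists_mul_circulantDet8_eq_of_even {u v : Fin 8 → ℤ} (h : ∀ i, u i ≡ v i [ZMOD 2])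
    (hu : ¬ Odd (u 0 + u 4 + (u 2 + u 6) + (u 1 + u 5 + (u 3 + u 7)))) :
    ∃ n, circulantDet8 u * circulantDet8 v = 2 ^ 10 * n ∧
      (Odd n ∨ 4 ∣ n ∨ HasExceptionalPrime n) := by
  have h0 := h 0
  have h1 := h 1
  have h2 := h 2
  have h3 := h 3
  have h4 := h 4
  have h5 := h 5
  have h6 := h 6
  have h7 := h 7
  simp only [Int.ModEq] at h0 h1 h2 h3 h4 h5 h6 h7
  by_cases h₀ : Odd (u 0 + u 4 + (u 2 + u 6))
  · have h₁ : Odd (u 1 + u 5 + (u 3 + u 7)) := by rw [Int.odd_iff] at *; omega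
    obtain ⟨e, a, b, c, d, hD, hab, hcd, he⟩ := exists_circulantDet8_eq h₀ h₁
    obtain ⟨e', a', b', c', d', hD', hab', hcd', he'⟩ := exists_circulantDet8_eq (u := v)
      (by rw [Int.odd_iff] at *; omega) (by rw [Int.odd_iff] at *; omega)
    refine ⟨e * (a ^ 2 + b ^ 2) * (c ^ 2 + d ^ 2) * (e' * (a' ^ 2 + b' ^ 2) * (c' ^ 2 + d' ^ 2)),
      by rw [hD, hD']; ring, ?_⟩
    by_cases g₁ : IsSemiprimary a b
    swap
    · exact Or.inr (Or.inr ((hasExceptionalPrime_sq_add_sq hab g₁).mono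
        ⟨e * (c ^ 2 + d ^ 2) * (e' * (a' ^ 2 + b' ^ 2) * (c' ^ 2 + d' ^ 2)), by ring⟩))
    by_cases g₂ : IsSemiprimary c d
    swap
    · exact Or.inr (Or.inr ((hasExceptionalPrime_sq_add_sq hcd g₂).mono
        ⟨e * (a ^ 2 + b ^ 2) * (e' * (a' ^ 2 + b' ^ 2) * (c' ^ 2 + d' ^ 2)), by ring⟩))
    by_cases g₃ : IsSemiprimary a' b'
    swap
    · exact Or.inr (Or.inr ((hasExceptionalPrime_sq_add_sq hab' g₃).mono
        ⟨e * (a ^ 2 + b ^ 2) * (c ^ 2 + d ^ 2) * (e' * (c' ^ 2 + d' ^ 2)), by ring⟩))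
    by_cases g₄ : IsSemiprimary c' d'
    swap
    · exact Or.inr (Or.inr ((hasExceptionalPrime_sq_add_sq hcd' g₄).mono
        ⟨e * (a ^ 2 + b ^ 2) * (c ^ 2 + d ^ 2) * (e' * (a' ^ 2 + b' ^ 2)), by ring⟩))
    have hee : e ≡ e' [ZMOD 2] :=
      (he g₁ g₂).trans ((crossTerm_modEq h).trans (he' g₃ g₄).symm)
    have hsq : ∀ {x y : ℤ}, Odd (x + y) → Odd (x ^ 2 + y ^ 2) := by
      intro x y hxy
      rw [Int.odd_add] at hxy ⊢
      rwa [Int.odd_pow' two_ne_zero, Int.even_pow' two_ne_zero]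
    rcases Int.even_or_odd e with ho | ho
    · obtain ⟨k, hk⟩ := ho
      obtain ⟨l, hl⟩ : ∃ l, e' = 2 * l := ⟨e' / 2, by simp only [Int.ModEq] at hee; omega⟩
      exact Or.inr (Or.inl ⟨k * (a ^ 2 + b ^ 2) * (c ^ 2 + d ^ 2) *
        (l * (a' ^ 2 + b' ^ 2) * (c' ^ 2 + d' ^ 2)), by rw [hk, hl]; ring⟩)
    · have ho' : Odd e' := by
        simp only [Int.ModEq] at hee
        rw [Int.odd_iff] at *
        omega
      exact Or.inl (((ho.mul (hsq hab)).mul (hsq hcd)).mul ((ho'.mul (hsq hab')).mul (hsq hcd')))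
  · have h₁ : ¬ Odd (u 1 + u 5 + (u 3 + u 7)) := by rw [Int.odd_iff] at *; omega
    obtain ⟨x, hx⟩ := sixtyFour_dvd_circulantDet8 (Int.not_odd_iff_even.mp h₀)
      (Int.not_odd_iff_even.mp h₁)
    obtain ⟨y, hy⟩ := sixtyFour_dvd_circulantDet8 (u := v)
      (by rw [← Int.not_odd_iff_even, Int.odd_iff] at *; omega)
      (by rw [← Int.not_odd_iff_even, Int.odd_iff] at *; omega)
    exact ⟨4 * (x * y), by rw [hx, hy]; ring, Or.inr (Or.inl (dvd_mul_right _ _))⟩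

/-! ### The Euclidean ring `ℤ[ζ]` and norms of primes -/

/-- The ring `ℤ[ζ]` of a primitive eighth root of unity `ζ`, as `ℤ[i][ζ]` with `ζ² = i`. The
coordinates of `x` on `1, ζ, ζ², ζ³` are `x.re.re`, `x.im.re`, `x.re.im`, `x.im.im`. -/
abbrev EighthCyclotomicInt : Type := QuadraticAlgebra GaussianInt ⟨0, 1⟩ 0

namespace EighthCyclotomicInt

/-- The element `r₀ + r₁ ζ + r₂ ζ² + r₃ ζ³`. -/
def mk (r₀ r₁ r₂ r₃ : ℤ) : EighthCyclotomicInt := ⟨⟨r₀, r₂⟩, ⟨r₁, r₃⟩⟩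

/-- The absolute norm. -/
def absNorm (x : EighthCyclotomicInt) : ℤ := Zsqrtd.norm (QuadraticAlgebra.norm x)

theorem exists_eq_mk (x : EighthCyclotomicInt) : ∃ r₀ r₁ r₂ r₃, x = mk r₀ r₁ r₂ r₃ :=
  ⟨x.re.re, x.im.re, x.re.im, x.im.im, rfl⟩

theorem mk_mul_mk (a₀ a₁ a₂ a₃ b₀ b₁ b₂ b₃ : ℤ) :
    mk a₀ a₁ a₂ a₃ * mk b₀ b₁ b₂ b₃ = mk (a₀ * b₀ - a₂ * b₂ - a₁ * b₃ - a₃ * b₁)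
      (a₀ * b₁ + a₁ * b₀ - a₂ * b₃ - a₃ * b₂) (a₀ * b₂ + a₂ * b₀ + a₁ * b₁ - a₃ * b₃)
      (a₀ * b₃ + a₃ * b₀ + a₁ * b₂ + a₂ * b₁) := by
  ext <;> simp [mk] <;> ring

theorem mk_sub_mk (a₀ a₁ a₂ a₃ b₀ b₁ b₂ b₃ : ℤ) :
    mk a₀ a₁ a₂ a₃ - mk b₀ b₁ b₂ b₃ = mk (a₀ - b₀) (a₁ - b₁) (a₂ - b₂) (a₃ - b₃) := by
  ext <;> simp [mk]

theorem mk_inj {a₀ a₁ a₂ a₃ b₀ b₁ b₂ b₃ : ℤ} :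
    mk a₀ a₁ a₂ a₃ = mk b₀ b₁ b₂ b₃ ↔ a₀ = b₀ ∧ a₁ = b₁ ∧ a₂ = b₂ ∧ a₃ = b₃ := by
  simp [mk, QuadraticAlgebra.ext_iff, Zsqrtd.ext_iff]
  tauto

theorem norm_mk (r₀ r₁ r₂ r₃ : ℤ) : QuadraticAlgebra.norm (mk r₀ r₁ r₂ r₃) =
    (⟨r₀ ^ 2 - r₂ ^ 2 + 2 * (r₁ * r₃), 2 * (r₀ * r₂) - r₁ ^ 2 + r₃ ^ 2⟩ : GaussianInt) := by
  rw [QuadraticAlgebra.norm_def]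
  ext <;> simp [mk] <;> ring

theorem absNorm_mk (r₀ r₁ r₂ r₃ : ℤ) :
    absNorm (mk r₀ r₁ r₂ r₃) = cyclotomicNorm8 r₀ r₁ r₂ r₃ := by
  rw [absNorm, norm_mk, Zsqrtd.norm_def, cyclotomicNorm8]
  ring

theorem absNorm_mul (x y : EighthCyclotomicInt) : absNorm (x * y) = absNorm x * absNorm y := by
  rw [absNorm, map_mul, Zsqrtd.norm_mul, absNorm, absNorm]

theorem absNorm_nonneg (x : EighthCyclotomicInt) : 0 ≤ absNorm x :=
  Zsqrtd.norm_nonneg (by norm_num) _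

theorem cyclotomicNorm8_eq_sq_sub (r₀ r₁ r₂ r₃ : ℤ) : cyclotomicNorm8 r₀ r₁ r₂ r₃ =
    (r₀ ^ 2 + r₁ ^ 2 + r₂ ^ 2 + r₃ ^ 2) ^ 2 -
      2 * (r₀ * r₁ + r₁ * r₂ + r₂ * r₃ - r₃ * r₀) ^ 2 := by
  unfold cyclotomicNorm8; ring

theorem absNorm_eq_zero_iff {x : EighthCyclotomicInt} : absNorm x = 0 ↔ x = 0 := by
  constructor
  · intro h
    obtain ⟨r₀, r₁, r₂, r₃, rfl⟩ := exists_eq_mk x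
    rw [absNorm_mk, cyclotomicNorm8_eq_sq_sub] at h
    have h2 : ∀ n : ℤ, (2 : ℤ) ≠ n * n := by
      intro n hn
      have : n < 2 := by nlinarith
      have : -2 < n := by nlinarith
      interval_cases n <;> omega
    have h' : Zsqrtd.norm (⟨r₀ ^ 2 + r₁ ^ 2 + r₂ ^ 2 + r₃ ^ 2,
        r₀ * r₁ + r₁ * r₂ + r₂ * r₃ - r₃ * r₀⟩ : ℤ√2) = 0 := by
      rw [Zsqrtd.norm_def]; linarith
    rw [Zsqrtd.norm_eq_zero h2, Zsqrtd.ext_iff] at h'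
    have h0 : r₀ ^ 2 + r₁ ^ 2 + r₂ ^ 2 + r₃ ^ 2 = 0 := h'.1
    have e0 : r₀ = 0 := by nlinarith [sq_nonneg r₀, sq_nonneg r₁, sq_nonneg r₂, sq_nonneg r₃]
    have e1 : r₁ = 0 := by nlinarith [sq_nonneg r₀, sq_nonneg r₁, sq_nonneg r₂, sq_nonneg r₃]
    have e2 : r₂ = 0 := by nlinarith [sq_nonneg r₀, sq_nonneg r₁, sq_nonneg r₂, sq_nonneg r₃]
    have e3 : r₃ = 0 := by nlinarith [sq_nonneg r₀, sq_nonneg r₁, sq_nonneg r₂, sq_nonneg r₃]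
    subst e0 e1 e2 e3
    rfl
  · rintro rfl
    simp [absNorm]

/-- An element of `ℚ(ζ)` with all coordinates at most `1/2` in absolute value has norm below `1`, here
with a common denominator `n`. The norm is at most the square of the sum of the squares of the
coordinates, and that bound is not attained at the corners of the box. -/
theorem cyclotomicNorm8_lt_pow {n r₀ r₁ r₂ r₃ : ℤ} (hn : 0 < n) (h₀ : |2 * r₀| ≤ n)
    (h₁ : |2 * r₁| ≤ n) (h₂ : |2 * r₂| ≤ n) (h₃ : |2 * r₃| ≤ n) :
    cyclotomicNorm8 r₀ r₁ r₂ r₃ < n ^ 4 := by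
  have sq : ∀ r : ℤ, |2 * r| ≤ n → 4 * r ^ 2 ≤ n ^ 2 := by
    intro r hr
    have := sq_le_sq' (abs_le.mp hr).1 (abs_le.mp hr).2
    linarith
  have g₀ := sq _ h₀
  have g₁ := sq _ h₁
  have g₂ := sq _ h₂
  have g₃ := sq _ h₃
  rw [cyclotomicNorm8_eq_sq_sub]
  have hS : 0 ≤ r₀ ^ 2 + r₁ ^ 2 + r₂ ^ 2 + r₃ ^ 2 := by positivity
  rcases (show r₀ ^ 2 + r₁ ^ 2 + r₂ ^ 2 + r₃ ^ 2 ≤ n ^ 2 by linarith).lt_or_eq with h | h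
  · have : (r₀ ^ 2 + r₁ ^ 2 + r₂ ^ 2 + r₃ ^ 2) ^ 2 < (n ^ 2) ^ 2 :=
      pow_lt_pow_left₀ h hS two_ne_zero
    nlinarith [sq_nonneg (r₀ * r₁ + r₁ * r₂ + r₂ * r₃ - r₃ * r₀)]
  · have hT : r₀ * r₁ + r₁ * r₂ + r₂ * r₃ - r₃ * r₀ ≠ 0 := by
      have key : ∀ r : ℤ, r ^ 2 = r₀ ^ 2 → r = r₀ ∨ r = -r₀ := fun r hr => sq_eq_sq_iff_eq_or_eq_neg.mp hr
      have h0 : r₀ ≠ 0 := by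
        rintro rfl
        nlinarith
      have hp : 0 < r₀ ^ 2 := by positivity
      rcases key r₁ (by linarith) with e₁ | e₁ <;> rcases key r₂ (by linarith) with e₂ | e₂ <;>
        rcases key r₃ (by linarith) with e₃ | e₃ <;> rw [e₁, e₂, e₃] <;> intro hT <;> nlinarith
    have := pow_pos (abs_pos.mpr hT) 2
    rw [sq_abs] at this
    rw [h]
    nlinarith

theorem exists_absNorm_sub_mul_lt (x : EighthCyclotomicInt) {y : EighthCyclotomicInt} (hy : y ≠ 0) :
    ∃ q, absNorm (x - y * q) < absNorm y := by
  have hpos : 0 < absNorm y :=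
    lt_of_le_of_ne (absNorm_nonneg y) (fun h => hy (absNorm_eq_zero_iff.mp h.symm))
  -- the product `z` of the other conjugates of `y`
  obtain ⟨z, hz⟩ : ∃ z, y * z = mk (absNorm y) 0 0 0 := by
    obtain ⟨a, b, c, d, rfl⟩ := exists_eq_mk y
    refine ⟨mk a (-b) c (-d) * mk (a ^ 2 - c ^ 2 + 2 * (b * d)) 0
      (-(2 * (a * c) - b ^ 2 + d ^ 2)) 0, ?_⟩
    rw [← mul_assoc, mk_mul_mk, mk_mul_mk, absNorm_mk, mk_inj, cyclotomicNorm8]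
    refine ⟨by ring, by ring, by ring, by ring⟩
  have hnz : absNorm z = absNorm y ^ 3 := by
    have := congrArg absNorm hz
    rw [absNorm_mul, absNorm_mk, cyclotomicNorm8] at this
    refine mul_left_cancel₀ hpos.ne' ?_
    rw [this]; ring
  obtain ⟨a, b, c, d, hx⟩ := exists_eq_mk (x * z)
  generalize absNorm y = n at *
  have round : ∀ m : ℤ, ∃ k, |2 * (m - n * k)| ≤ n := by
    intro m
    refine ⟨(2 * m + n) / (2 * n), ?_⟩
    have h1 := Int.emod_add_mul_ediv (2 * m + n) (2 * n)
    have h2 := Int.emod_nonneg (2 * m + n) (show 2 * n ≠ 0 by omega)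
    have h3 := Int.emod_lt_of_pos (2 * m + n) (show 0 < 2 * n by omega)
    rw [abs_le]
    constructor <;> linarith
  obtain ⟨a', ha⟩ := round a
  obtain ⟨b', hb⟩ := round b
  obtain ⟨c', hc⟩ := round c
  obtain ⟨d', hd⟩ := round d
  refine ⟨mk a' b' c' d', ?_⟩
  have h1 : (x - y * mk a' b' c' d') * z =
      mk (a - n * a') (b - n * b') (c - n * c') (d - n * d') := by
    rw [sub_mul, hx, mul_right_comm, hz, mk_mul_mk, mk_sub_mk, mk_inj]
    refine ⟨by ring, by ring, by ring, by ring⟩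
  have h2 := congrArg absNorm h1
  rw [absNorm_mul, absNorm_mk, hnz] at h2
  have h3 := cyclotomicNorm8_lt_pow hpos ha hb hc hd
  rw [← h2] at h3
  refine lt_of_mul_lt_mul_right (a := n ^ 3) ?_ (by positivity)
  rwa [← pow_succ']

open Classical in
/-- `ℤ[ζ]` is Euclidean for the absolute value of the norm. -/
noncomputable instance : EuclideanDomain EighthCyclotomicInt where
  quotient x y := if hy : y = 0 then 0 else (exists_absNorm_sub_mul_lt x hy).choose
  quotient_zero x := by simp
  remainder x y := if hy : y = 0 then x else x - y * (exists_absNorm_sub_mul_lt x hy).choose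
  quotient_mul_add_remainder_eq x y := by
    by_cases hy : y = 0 <;> simp [hy]
  r x y := (absNorm x).natAbs < (absNorm y).natAbs
  r_wellFounded := (measure fun x => (absNorm x).natAbs).wf
  remainder_lt x y hy := by
    rw [dif_neg hy]
    have := (exists_absNorm_sub_mul_lt x hy).choose_spec
    have := absNorm_nonneg (x - y * (exists_absNorm_sub_mul_lt x hy).choose)
    omega
  mul_left_not_lt x y hy := by
    rw [absNorm_mul, Int.natAbs_mul, not_lt]
    refine Nat.le_mul_of_pos_right _ (Int.natAbs_pos.mpr ?_)
    rwa [Ne, absNorm_eq_zero_iff]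

/-- If `p` divides `x y` but not `y`, then `p` and `x` have a common factor that is not a unit. -/
theorem exists_absNorm_dvd_of_dvd_mul {p : ℤ} {x y : EighthCyclotomicInt}
    (h : mk p 0 0 0 ∣ x * y) (hy : ¬ mk p 0 0 0 ∣ y) :
    ∃ g, absNorm g ∣ p ^ 4 ∧ absNorm g ∣ absNorm x ∧ absNorm g ≠ 1 := by
  refine ⟨EuclideanDomain.gcd (mk p 0 0 0) x, ?_, ?_, ?_⟩
  · obtain ⟨z, hz⟩ := EuclideanDomain.gcd_dvd_left (mk p 0 0 0) x
    have := congrArg absNorm hz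
    rw [absNorm_mul, absNorm_mk, cyclotomicNorm8] at this
    exact ⟨absNorm z, by rw [← this]; ring⟩
  · obtain ⟨z, hz⟩ := EuclideanDomain.gcd_dvd_right (mk p 0 0 0) x
    have := congrArg absNorm hz
    rw [absNorm_mul] at this
    exact ⟨_, this⟩
  · intro h1
    have hu : IsUnit (EuclideanDomain.gcd (mk p 0 0 0) x) := by
      rw [QuadraticAlgebra.isUnit_iff_norm_isUnit]
      exact Zsqrtd.norm_eq_one_iff.mp (by rw [absNorm] at h1; rw [h1]; rfl)
    exact hy (((EuclideanDomain.gcd_isUnit_iff.mp hu)).dvd_of_dvd_mul_left h)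

/-- The norm of a greatest common divisor of `p` and `ζ - w` is `p`, where `w` is a primitive eighth
root of unity modulo `p`. -/
theorem exists_cyclotomicNorm8_eq_prime {p : ℕ} (hp : p.Prime) (h8 : p % 8 = 1) :
    ∃ r₀ r₁ r₂ r₃ : ℤ, cyclotomicNorm8 r₀ r₁ r₂ r₃ = p := by
  have := Fact.mk hp
  have hp' : Prime (p : ℤ) := Nat.prime_iff_prime_int.mp hp
  have hp1 : ¬ (p : ℤ) ∣ 1 := fun h => hp'.not_isUnit (isUnit_of_dvd_one h)
  -- a primitive eighth root of unity modulo `p`, from square roots of `-1` and `2`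
  obtain ⟨w, hw⟩ : ∃ w : ℤ, (p : ℤ) ∣ w ^ 4 + 1 := by
    obtain ⟨i, hi⟩ := (ZMod.exists_sq_eq_neg_one_iff (p := p)).mpr (by omega)
    obtain ⟨t, ht⟩ := (ZMod.exists_sq_eq_two_iff (p := p) (by omega)).mpr (Or.inl h8)
    have ht0 : t ≠ 0 := by
      rintro rfl
      have h2 : ((2 : ℕ) : ZMod p) = 0 := by rw [Nat.cast_ofNat, ht, mul_zero]
      rw [ZMod.natCast_eq_zero_iff] at h2
      have := Nat.le_of_dvd two_pos h2
      have := hp.two_le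
      omega
    obtain ⟨w, hw⟩ := ZMod.intCast_surjective ((1 + i) / t)
    refine ⟨w, (ZMod.intCast_zmod_eq_zero_iff_dvd _ p).mp ?_⟩
    push_cast
    rw [hw, div_pow, div_add_one (pow_ne_zero 4 ht0), div_eq_zero_iff]
    left
    linear_combination (-(i ^ 2) - 4 * i - 5) * hi - (t ^ 2 + 2) * ht
  -- replacing `w` by `w + p` if need be, `w ^ 4 + 1` is divisible by `p` only once
  obtain ⟨w, hw, hw2⟩ : ∃ w : ℤ, (p : ℤ) ∣ w ^ 4 + 1 ∧ ¬ (p : ℤ) ^ 2 ∣ w ^ 4 + 1 := by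
    by_cases h2 : (p : ℤ) ^ 2 ∣ w ^ 4 + 1
    · refine ⟨w + p, ?_, ?_⟩
      · obtain ⟨k, hk⟩ := hw
        exact ⟨k + (4 * w ^ 3 + 6 * w ^ 2 * p + 4 * w * p ^ 2 + p ^ 3), by
          linear_combination hk⟩
      · rintro ⟨l, hl⟩
        obtain ⟨k, hk⟩ := h2
        have h4 : (p : ℤ) ∣ 4 * w ^ 3 := by
          refine ⟨l - k - 6 * w ^ 2 - 4 * w * p - p ^ 2, mul_left_cancel₀ hp'.ne_zero ?_⟩
          linear_combination hl - hk
        rcases hp'.dvd_or_dvd h4 with h | h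
        · have h4' : p ∣ 2 ^ 2 := by exact_mod_cast h
          have := Nat.le_of_dvd two_pos (hp.dvd_of_dvd_pow h4')
          have := hp.two_le
          omega
        · have hpw := hp'.dvd_of_dvd_pow h
          exact hp1 ((Int.dvd_add_right (dvd_pow hpw four_ne_zero)).mp hw)
    · exact ⟨w, hw, h2⟩
  obtain ⟨k, hk⟩ := hw
  obtain ⟨g, hg4, hgx, hg1⟩ := exists_absNorm_dvd_of_dvd_mul (p := p) (x := mk (-w) 1 0 0)
    (y := mk (w ^ 3) (w ^ 2) w 1)
    ⟨mk (-k) 0 0 0, by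
      rw [mk_mul_mk, mk_mul_mk, mk_inj]
      exact ⟨by linear_combination -hk, by ring, by ring, by ring⟩⟩
    (fun h => by
      obtain ⟨z, hz⟩ := h
      obtain ⟨c₀, c₁, c₂, c₃, rfl⟩ := exists_eq_mk z
      rw [mk_mul_mk, mk_inj] at hz
      exact hp1 ⟨c₃, by linarith [hz.2.2.2]⟩)
  rw [absNorm_mk, show cyclotomicNorm8 (-w) 1 0 0 = w ^ 4 + 1 by unfold cyclotomicNorm8; ring] at hgx
  obtain ⟨r₀, r₁, r₂, r₃, rfl⟩ := exists_eq_mk g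
  refine ⟨r₀, r₁, r₂, r₃, ?_⟩
  rw [← absNorm_mk]
  have hnn := absNorm_nonneg (mk r₀ r₁ r₂ r₃)
  obtain ⟨n, hn⟩ := Int.eq_ofNat_of_zero_le hnn
  rw [hn] at hg4 hgx hg1 ⊢
  obtain ⟨j, -, rfl⟩ := (Nat.dvd_prime_pow hp).mp (by exact_mod_cast hg4 : n ∣ p ^ 4)
  rcases j with _ | _ | j
  · simp at hg1
  · simp
  · exact absurd (Dvd.dvd.trans ⟨(p : ℤ) ^ j, by push_cast; ring⟩ hgx) hw2

/-- The norm of a greatest common divisor of `p` and `ζ + ζ³ - w` is `p ^ 2`, where `w ^ 2 ≡ -2`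
modulo `p`. -/
theorem exists_cyclotomicNorm8_eq_prime_sq {p : ℕ} (hp : p.Prime) (h8 : p % 8 = 3) :
    ∃ r₀ r₁ r₂ r₃ : ℤ, cyclotomicNorm8 r₀ r₁ r₂ r₃ = (p : ℤ) ^ 2 := by
  have := Fact.mk hp
  have hp' : Prime (p : ℤ) := Nat.prime_iff_prime_int.mp hp
  have hp1 : ¬ (p : ℤ) ∣ 1 := fun h => hp'.not_isUnit (isUnit_of_dvd_one h)
  have hp2 : ¬ (p : ℤ) ∣ 2 := by
    intro h
    have h' : p ∣ 2 := by exact_mod_cast h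
    have := Nat.le_of_dvd two_pos h'
    omega
  obtain ⟨w, hw⟩ : ∃ w : ℤ, (p : ℤ) ∣ w ^ 2 + 2 := by
    obtain ⟨t, ht⟩ := (ZMod.exists_sq_eq_neg_two_iff (p := p) (by omega)).mpr (Or.inr h8)
    obtain ⟨w, rfl⟩ := ZMod.intCast_surjective t
    refine ⟨w, (ZMod.intCast_zmod_eq_zero_iff_dvd _ p).mp ?_⟩
    push_cast
    linear_combination -ht
  obtain ⟨w, hw, hw2⟩ : ∃ w : ℤ, (p : ℤ) ∣ w ^ 2 + 2 ∧ ¬ (p : ℤ) ^ 2 ∣ w ^ 2 + 2 := by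
    by_cases h2 : (p : ℤ) ^ 2 ∣ w ^ 2 + 2
    · refine ⟨w + p, ?_, ?_⟩
      · obtain ⟨k, hk⟩ := hw
        exact ⟨k + (2 * w + p), by linear_combination hk⟩
      · rintro ⟨l, hl⟩
        obtain ⟨k, hk⟩ := h2
        have h4 : (p : ℤ) ∣ 2 * w := by
          refine ⟨l - k - 1, mul_left_cancel₀ hp'.ne_zero ?_⟩
          linear_combination hl - hk
        rcases hp'.dvd_or_dvd h4 with h | h
        · exact hp2 h
        · exact hp2 ((Int.dvd_add_right (dvd_pow h two_ne_zero)).mp hw)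
    · exact ⟨w, hw, h2⟩
  obtain ⟨k, hk⟩ := hw
  -- `ζ + ζ³` is a square root of `-2`, and `-(ζ + ζ³)` is its conjugate over `ℚ`
  obtain ⟨g, hg4, hgx, hg1⟩ := exists_absNorm_dvd_of_dvd_mul (p := p) (x := mk (-w) 1 0 1)
    (y := mk (-w) (-1) 0 (-1))
    ⟨mk k 0 0 0, by
      rw [mk_mul_mk, mk_mul_mk, mk_inj]
      exact ⟨by linear_combination hk, by ring, by ring, by ring⟩⟩
    (fun h => by
      obtain ⟨z, hz⟩ := h
      obtain ⟨c₀, c₁, c₂, c₃, rfl⟩ := exists_eq_mk z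
      rw [mk_mul_mk, mk_inj] at hz
      exact hp1 ⟨-c₁, by linarith [hz.2.1]⟩)
  rw [absNorm_mk, show cyclotomicNorm8 (-w) 1 0 1 = (w ^ 2 + 2) ^ 2 by
    unfold cyclotomicNorm8; ring] at hgx
  obtain ⟨r₀, r₁, r₂, r₃, rfl⟩ := exists_eq_mk g
  refine ⟨r₀, r₁, r₂, r₃, ?_⟩
  rw [← absNorm_mk]
  have hnn := absNorm_nonneg (mk r₀ r₁ r₂ r₃)
  obtain ⟨n, hn⟩ := Int.eq_ofNat_of_zero_le hnn
  have hXY := absNorm_mk r₀ r₁ r₂ r₃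
  rw [hn] at hg4 hgx hg1 hXY ⊢
  obtain ⟨j, -, rfl⟩ := (Nat.dvd_prime_pow hp).mp (by exact_mod_cast hg4 : n ∣ p ^ 4)
  rcases j with _ | _ | _ | j
  · simp at hg1
  · -- a prime `≡ 3` modulo `4` is not a sum of two squares
    exfalso
    rw [cyclotomicNorm8] at hXY
    obtain ⟨⟨x, hx⟩, ⟨y, hy⟩⟩ := hp.dvd_of_dvd_sq_add_sq (q := p) (by omega) ⟨1, by
      rw [← hXY]; push_cast; ring⟩
    rw [hx, hy] at hXY
    refine hp1 ⟨x ^ 2 + y ^ 2, mul_left_cancel₀ hp'.ne_zero ?_⟩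
    push_cast at hXY
    linear_combination hXY
  · simp
  · exfalso
    have h3 : (p : ℤ) ^ 3 ∣ (w ^ 2 + 2) ^ 2 := Dvd.dvd.trans ⟨(p : ℤ) ^ j, by push_cast; ring⟩ hgx
    rw [hk] at h3
    obtain ⟨l, hl⟩ := h3
    have hpk : (p : ℤ) ∣ k := by
      refine hp'.dvd_of_dvd_pow (n := 2) ⟨l, mul_left_cancel₀ (pow_ne_zero 2 hp'.ne_zero) ?_⟩
      linear_combination hl
    obtain ⟨m, rfl⟩ := hpk
    exact hw2 ⟨m, by rw [hk]; ring⟩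

end EighthCyclotomicInt

/-- Uniqueness of the representation of a prime as a sum of two squares. -/
theorem Nat.Prime.sq_add_sq_unique {p : ℕ} (hp : p.Prime) {a b c d : ℤ}
    (h : (p : ℤ) = a ^ 2 + b ^ 2) (h' : (p : ℤ) = c ^ 2 + d ^ 2) :
    (c ^ 2 = a ^ 2 ∧ d ^ 2 = b ^ 2) ∨ (c ^ 2 = b ^ 2 ∧ d ^ 2 = a ^ 2) := by
  obtain ⟨x, y, b', hb, hx, hy⟩ := exists_eq_mul_of_prime_dvd_sq_add_sq hp h ⟨1, by rw [← h', mul_one]⟩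
  have hb2 : b' ^ 2 = b ^ 2 := by rcases hb with rfl | rfl <;> ring
  have e : (p : ℤ) * (x ^ 2 + y ^ 2) = p * 1 := by
    have : c ^ 2 + d ^ 2 = (a ^ 2 + b' ^ 2) * (x ^ 2 + y ^ 2) := by rw [hx, hy]; ring
    rw [hb2, ← h, ← h'] at this
    linarith
  have hxy := mul_left_cancel₀ (by exact_mod_cast hp.ne_zero) e
  have hx1 : -1 ≤ x ∧ x ≤ 1 := by constructor <;> nlinarith [sq_nonneg y]
  have hxc : x = -1 ∨ x = 0 ∨ x = 1 := by omega
  rcases hxc with rfl | rfl | rfl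
  · have : y = 0 := by nlinarith
    subst this
    left; constructor <;> [rw [hx]; rw [hy, ← hb2]] <;> ring
  · right
    exact ⟨by rw [hx, ← hb2]; linear_combination b' ^ 2 * hxy, by
      rw [hy]; linear_combination a ^ 2 * hxy⟩
  · have : y = 0 := by nlinarith
    subst this
    left; constructor <;> [rw [hx]; rw [hy, ← hb2]] <;> ring

/-! ### Realization of the values -/

theorem circulantDet8_vec (a₀ a₁ a₂ a₃ a₄ a₅ a₆ a₇ : ℤ) :
    circulantDet8 ![a₀, a₁, a₂, a₃, a₄, a₅, a₆, a₇] =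
      circulantDet4 (a₀ + a₄) (a₁ + a₅) (a₂ + a₆) (a₃ + a₇) *
        cyclotomicNorm8 (a₀ - a₄) (a₁ - a₅) (a₂ - a₆) (a₃ - a₇) :=
  rfl

theorem one_add_sixteen_mul_mem (m : ℤ) :
    16 * m + 1 ∈ integerGroupDeterminants (CyclicGroup 8 × CyclicGroup 2) := by
  rw [mem_integerGroupDeterminants_cyclicProd_iff]
  refine ⟨![1 + 2 * m, 2 * m, 2 * m, 2 * m, 2 * m, 2 * m, 2 * m, 2 * m],
    ![1, 0, 0, 0, 0, 0, 0, 0], fun i => ?_, ?_⟩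
  · fin_cases i <;> simp [Int.ModEq]
  · rw [circulantDet8_vec, circulantDet8_vec]
    unfold circulantDet4 cyclotomicNorm8
    ring

theorem setA_subset : setA ⊆ integerGroupDeterminants (CyclicGroup 8 × CyclicGroup 2) := by
  rintro _ ⟨k, l, h, rfl⟩
  rw [mem_integerGroupDeterminants_cyclicProd_iff]
  refine ⟨![k - 1, k - 1, k - 1, k, k, k, k, k], ![l - 1, l - 1, l - 1, l, l, l, l, l],
    fun i => ?_, ?_⟩
  · fin_cases i <;> simp [Int.ModEq] at h ⊢ <;> omega
  · rw [circulantDet8_vec, circulantDet8_vec]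
    unfold circulantDet4 cyclotomicNorm8
    ring

theorem two_pow_ten_mul_odd_mem (m : ℤ) :
    2 ^ 10 * (2 * m + 1) ∈ integerGroupDeterminants (CyclicGroup 8 × CyclicGroup 2) := by
  rw [mem_integerGroupDeterminants_cyclicProd_iff]
  -- the first determinant is `32 (4 k + 1)` or `32 (4 l + 1)`, the second one `32` or `-32`
  rcases Int.even_or_odd' m with ⟨k, rfl | rfl⟩
  · refine ⟨![1 + 2 * k, 1 + 2 * k, 1 + 2 * k, 2 * k, 1 + 2 * k, 2 * k, 2 * k, 2 * k],
      ![1, 1, 1, 0, 1, 0, 0, 0], fun i => ?_, ?_⟩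
    · fin_cases i <;> simp [Int.ModEq]
    · rw [circulantDet8_vec, circulantDet8_vec]
      unfold circulantDet4 cyclotomicNorm8
      ring
  · obtain ⟨l, rfl⟩ : ∃ l, k = -l - 1 := ⟨-k - 1, by ring⟩
    refine ⟨![1 + 2 * l, 1 + 2 * l, 1 + 2 * l, 2 * l, 1 + 2 * l, 2 * l, 2 * l, 2 * l],
      ![-1, 1, 1, 0, 1, 0, 0, 2], fun i => ?_, ?_⟩
    · fin_cases i <;> simp [Int.ModEq]
    · rw [circulantDet8_vec, circulantDet8_vec]
      unfold circulantDet4 cyclotomicNorm8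
      ring

theorem two_pow_twelve_mul_mem (m : ℤ) :
    2 ^ 12 * m ∈ integerGroupDeterminants (CyclicGroup 8 × CyclicGroup 2) := by
  rw [mem_integerGroupDeterminants_cyclicProd_iff]
  -- the sum of the first vector is `8 m`
  rcases Int.even_or_odd' m with ⟨k, rfl | rfl⟩
  · refine ⟨![-1 + 2 * k, 1 + 2 * k, 2 * k, 2 * k, 2 * k, 2 * k, 2 * k, 2 * k],
      ![1, 1, 0, 0, 0, 2, 2, 2], fun i => ?_, ?_⟩
    · fin_cases i <;> simp [Int.ModEq]
    · rw [circulantDet8_vec, circulantDet8_vec]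
      unfold circulantDet4 cyclotomicNorm8
      ring
  · refine ⟨![1 + 2 * k, 1 + 2 * k, 1 + 2 * k, 1 + 2 * k, 1 + 2 * k, 1 + 2 * k, 2 * k, 2 + 2 * k],
      ![-1, 1, -1, 1, -1, 1, 0, 2], fun i => ?_, ?_⟩
    · fin_cases i <;> simp [Int.ModEq]
    · rw [circulantDet8_vec, circulantDet8_vec]
      unfold circulantDet4 cyclotomicNorm8
      ring

/-- The values with an exceptional prime come from the vector `(1, 1, 0, 0, 0, 2, 2, 2)`, translated
by even constants so as to give an arbitrary odd factor, and a congruent vector. -/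
theorem two_pow_eleven_mul_mem_of_circulantDet8_eq {v : Fin 8 → ℤ} {n : ℤ}
    (h : ∀ i, v i ≡ ![1, 1, 0, 0, 0, 0, 0, 0] i [ZMOD 2])
    (hv : circulantDet8 v = 32 * n ∨ circulantDet8 v = -32 * n) (m : ℤ) :
    2 ^ 11 * n * (2 * m + 1) ∈ integerGroupDeterminants (CyclicGroup 8 × CyclicGroup 2) := by
  rw [mem_integerGroupDeterminants_cyclicProd_iff]
  have key : ∀ l : ℤ, (∀ i, ![1 + 2 * l, 1 + 2 * l, 2 * l, 2 * l, 2 * l, 2 + 2 * l, 2 + 2 * l,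
        2 + 2 * l] i ≡ v i [ZMOD 2]) ∧
      circulantDet8 ![1 + 2 * l, 1 + 2 * l, 2 * l, 2 * l, 2 * l, 2 + 2 * l, 2 + 2 * l,
        2 + 2 * l] = -64 * (2 * l + 1) := by
    refine fun l => ⟨fun i => Int.ModEq.trans ?_ (h i).symm, ?_⟩
    · fin_cases i <;> simp [Int.ModEq]
    · rw [circulantDet8_vec]
      unfold circulantDet4 cyclotomicNorm8
      ring
  rcases hv with hv | hv
  · exact ⟨_, v, (key (-m - 1)).1, by rw [(key (-m - 1)).2, hv]; ring⟩
  · exact ⟨_, v, (key m).1, by rw [(key m).2, hv]; ring⟩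

theorem two_pow_eleven_mul_mem_of_mod_eight_eq_five {p : ℕ} (hp : p.Prime)
    (h8 : (p : ℤ) ≡ -3 [ZMOD 8]) (m : ℤ) :
    2 ^ 11 * (p : ℤ) * (2 * m + 1) ∈
      integerGroupDeterminants (CyclicGroup 8 × CyclicGroup 2) := by
  simp only [Int.ModEq] at h8
  have := Fact.mk hp
  have key : ∀ a b : ℤ, 2 * (p : ℤ) = a ^ 2 + b ^ 2 → (a % 8 = 3 ∨ a % 8 = 5) →
      (b % 8 = 1 ∨ b % 8 = 7) → 2 ^ 11 * (p : ℤ) * (2 * m + 1) ∈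
      integerGroupDeterminants (CyclicGroup 8 × CyclicGroup 2) := by
    intro a b hab ha hb
    obtain ⟨s, hs⟩ : ∃ s, a ^ 2 = (3 + 8 * s) ^ 2 := by
      rcases ha with ha | ha
      · exact ⟨a / 8, by rw [show 3 + 8 * (a / 8) = a by omega]⟩
      · exact ⟨-(a / 8) - 1, by rw [show 3 + 8 * (-(a / 8) - 1) = -a by omega, neg_sq]⟩
    obtain ⟨t, ht⟩ : ∃ t, b ^ 2 = (8 * t - 1) ^ 2 := by
      rcases hb with hb | hb
      · exact ⟨-(b / 8), by rw [show 8 * (-(b / 8)) - 1 = -b by omega, neg_sq]⟩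
      · exact ⟨b / 8 + 1, by rw [show 8 * (b / 8 + 1) - 1 = b by omega]⟩
    refine two_pow_eleven_mul_mem_of_circulantDet8_eq
      (v := ![1 + 2 * s, -1 + 2 * t, -2 * s, -2 * t, 2 + 2 * s, 2 * t, -2 * s, -2 * t])
      (fun i => ?_) (Or.inl ?_) m
    · fin_cases i <;> simp [Int.ModEq]
    · rw [circulantDet8_vec]
      unfold circulantDet4 cyclotomicNorm8
      linear_combination -16 * hab - 16 * hs - 16 * ht
  obtain ⟨c, d, hcd⟩ := Nat.Prime.sq_add_sq (p := p) (by omega)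
  have hcd' : 2 * (p : ℤ) = ((c : ℤ) + d) ^ 2 + ((c : ℤ) - d) ^ 2 := by
    rw [← hcd]; push_cast; ring
  have hmod : ∀ x : ℤ, x % 2 = 1 → (x % 8 = 3 ∨ x % 8 = 5) ∧ x ^ 2 % 16 = 9 ∨
      (x % 8 = 1 ∨ x % 8 = 7) ∧ x ^ 2 % 16 = 1 := by
    intro x hx
    have : x % 8 = 1 ∨ x % 8 = 3 ∨ x % 8 = 5 ∨ x % 8 = 7 := by omega
    obtain ⟨k, rfl⟩ | ⟨k, rfl⟩ | ⟨k, rfl⟩ | ⟨k, rfl⟩ : (∃ k, x = 8 * k + 1) ∨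
        (∃ k, x = 8 * k + 3) ∨ (∃ k, x = 8 * k + 5) ∨ (∃ k, x = 8 * k + 7) := by
      rcases this with h | h | h | h
      exacts [Or.inl ⟨x / 8, by omega⟩, Or.inr (Or.inl ⟨x / 8, by omega⟩),
        Or.inr (Or.inr (Or.inl ⟨x / 8, by omega⟩)), Or.inr (Or.inr (Or.inr ⟨x / 8, by omega⟩))]
    all_goals ring_nf; omega
  have hodd : ((c : ℤ) + d) % 2 = 1 := by
    obtain ⟨k, hk⟩ := exists_sq_add_self_eq_two_mul c
    obtain ⟨l, hl⟩ := exists_sq_add_self_eq_two_mul d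
    have : (c : ℤ) ^ 2 + (d : ℤ) ^ 2 = p := by exact_mod_cast hcd
    omega
  have h₁ := hmod ((c : ℤ) + d) hodd
  have h₂ := hmod ((c : ℤ) - d) (by omega)
  rcases h₁ with ⟨h₁, e₁⟩ | ⟨h₁, e₁⟩ <;> rcases h₂ with ⟨h₂, e₂⟩ | ⟨h₂, e₂⟩
  · omega
  · exact key _ _ hcd' h₁ h₂
  · exact key _ _ (by rw [hcd', add_comm]) h₂ h₁
  · omega

/-- Multiplication of `r₀ + r₁ ζ + r₂ ζ² + r₃ ζ³` by a power of `ζ` makes the first two coordinates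
odd and the last two even; the condition modulo `8` then says that exactly one of the latter is
divisible by `4`. -/
theorem exists_normalized_cyclotomicNorm8 {r₀ r₁ r₂ r₃ : ℤ} (h₀ : (r₀ + r₂) % 2 = 1)
    (h₁ : (r₁ + r₃) % 2 = 1) (hX : (r₀ ^ 2 - r₂ ^ 2 + 2 * (r₁ * r₃)) % 8 = 3 ∨
      (r₀ ^ 2 - r₂ ^ 2 + 2 * (r₁ * r₃)) % 8 = 5) :
    ∃ s₀ s₁ s₂ s₃ : ℤ, cyclotomicNorm8 s₀ s₁ s₂ s₃ = cyclotomicNorm8 r₀ r₁ r₂ r₃ ∧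
      s₀ % 2 = 1 ∧ s₁ % 2 = 1 ∧ s₂ % 2 = 0 ∧ s₃ % 2 = 0 ∧ (s₂ + s₃) % 4 = 2 := by
  rcases Int.even_or_odd' r₀ with ⟨a, rfl | rfl⟩ <;>
  rcases Int.even_or_odd' r₁ with ⟨b, rfl | rfl⟩ <;>
  rcases Int.even_or_odd' r₂ with ⟨c, rfl | rfl⟩ <;>
  rcases Int.even_or_odd' r₃ with ⟨d, rfl | rfl⟩ <;>
  first
  | (exfalso; omega)
  | skip
  all_goals
    obtain ⟨k, hk⟩ := exists_sq_add_self_eq_two_mul a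
    obtain ⟨l, hl⟩ := exists_sq_add_self_eq_two_mul b
    obtain ⟨m, hm⟩ := exists_sq_add_self_eq_two_mul c
    obtain ⟨n, hn⟩ := exists_sq_add_self_eq_two_mul d
    ring_nf at hk hl hm hn hX
  · exact ⟨2 * c + 1, 2 * d + 1, -(2 * a), -(2 * b), by unfold cyclotomicNorm8; ring, by omega,
      by omega, by omega, by omega, by omega⟩
  · exact ⟨2 * b + 1, 2 * c + 1, 2 * d, -(2 * a), by unfold cyclotomicNorm8; ring, by omega,
      by omega, by omega, by omega, by omega⟩
  · exact ⟨-(2 * d + 1), 2 * a + 1, 2 * b, 2 * c, by unfold cyclotomicNorm8; ring, by omega,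
      by omega, by omega, by omega, by omega⟩
  · exact ⟨2 * a + 1, 2 * b + 1, 2 * c, 2 * d, by unfold cyclotomicNorm8; ring, by omega,
      by omega, by omega, by omega, by omega⟩

/-- The vector `v` is found from its images in `ℤ[x]/(x⁴ - 1)` and `ℤ[x]/(x⁴ + 1) = ℤ[ζ]`: the latter
is an associate of `(1 + ζ) γ`, where `γ = g₀ + g₁ ζ + g₂ ζ² + g₃ ζ³`, and the former has the
group determinant `±16` and agrees with it modulo `4`. -/
theorem two_pow_eleven_mul_cyclotomicNorm8_mem {g₀ g₁ g₂ g₃ : ℤ}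
    (h : (g₀ ^ 2 - g₂ ^ 2 + 2 * (g₁ * g₃) + (2 * (g₀ * g₂) - g₁ ^ 2 + g₃ ^ 2)) % 8 = 3 ∨
      (g₀ ^ 2 - g₂ ^ 2 + 2 * (g₁ * g₃) + (2 * (g₀ * g₂) - g₁ ^ 2 + g₃ ^ 2)) % 8 = 5) (m : ℤ) :
    2 ^ 11 * cyclotomicNorm8 g₀ g₁ g₂ g₃ * (2 * m + 1) ∈
      integerGroupDeterminants (CyclicGroup 8 × CyclicGroup 2) := by
  have hodd : (g₀ + g₁ + g₂ + g₃) % 2 = 1 := by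
    obtain ⟨a, ha⟩ := exists_sq_add_self_eq_two_mul g₀
    obtain ⟨b, hb⟩ := exists_sq_add_self_eq_two_mul g₁
    obtain ⟨c, hc⟩ := exists_sq_add_self_eq_two_mul g₂
    obtain ⟨d, hd⟩ := exists_sq_add_self_eq_two_mul g₃
    omega
  obtain ⟨r₀, r₁, r₂, r₃, hr, h₀, h₁, h₂, h₃, h₂₃⟩ := exists_normalized_cyclotomicNorm8
    (r₀ := g₀ - g₃) (r₁ := g₀ + g₁) (r₂ := g₁ + g₂) (r₃ := g₂ + g₃) (by omega) (by omega)
    (by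
      convert h using 3 <;> ring)
  have hN : cyclotomicNorm8 r₀ r₁ r₂ r₃ = 2 * cyclotomicNorm8 g₀ g₁ g₂ g₃ := by
    rw [hr]; unfold cyclotomicNorm8; ring
  have sgn : ∀ r : ℤ, r % 2 = 1 → ∃ k, r + 4 * k = 1 ∨ r + 4 * k = -1 := by
    intro r hr
    have : r % 4 = 1 ∨ r % 4 = 3 := by omega
    rcases this with h | h
    exacts [⟨-(r / 4), by omega⟩, ⟨-(r / 4) - 1, by omega⟩]
  obtain ⟨k₀, hk₀⟩ := sgn r₀ h₀
  obtain ⟨k₁, hk₁⟩ := sgn r₁ h₁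
  have sq : ∀ x : ℤ, x = 1 ∨ x = -1 → x ^ 2 = 1 := by rintro x (rfl | rfl) <;> rfl
  have e₀ := sq _ hk₀
  have e₁ := sq _ hk₁
  have fin : ∀ k₂ k₃ : ℤ, circulantDet4 (r₀ + 4 * k₀) (r₁ + 4 * k₁) (r₂ + 4 * k₂) (r₃ + 4 * k₃) = 16 ∨
      circulantDet4 (r₀ + 4 * k₀) (r₁ + 4 * k₁) (r₂ + 4 * k₂) (r₃ + 4 * k₃) = -16 →
      2 ^ 11 * cyclotomicNorm8 g₀ g₁ g₂ g₃ * (2 * m + 1) ∈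
      integerGroupDeterminants (CyclicGroup 8 × CyclicGroup 2) := by
    intro k₂ k₃ hk
    refine two_pow_eleven_mul_mem_of_circulantDet8_eq
      (v := ![r₀ + 2 * k₀, r₁ + 2 * k₁, r₂ + 2 * k₂, r₃ + 2 * k₃, 2 * k₀, 2 * k₁, 2 * k₂, 2 * k₃])
      (fun i => ?_) ?_ m
    · fin_cases i <;> simp [Int.ModEq] <;> omega
    · have e : circulantDet8
          ![r₀ + 2 * k₀, r₁ + 2 * k₁, r₂ + 2 * k₂, r₃ + 2 * k₃, 2 * k₀, 2 * k₁, 2 * k₂, 2 * k₃] =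
          circulantDet4 (r₀ + 4 * k₀) (r₁ + 4 * k₁) (r₂ + 4 * k₂) (r₃ + 4 * k₃) *
            cyclotomicNorm8 r₀ r₁ r₂ r₃ := by
        rw [circulantDet8_vec]
        congr 1 <;> congr 1 <;> ring
      rw [e, hN]
      rcases hk with hk | hk <;> rw [hk]
      · left; ring
      · right; ring
  generalize r₀ + 4 * k₀ = p₀ at *
  generalize r₁ + 4 * k₁ = p₁ at *
  by_cases h2 : r₂ % 4 = 2
  · obtain ⟨k₂, hk₂⟩ : ∃ k₂, r₂ + 4 * k₂ = 2 * p₀ := ⟨(2 * p₀ - r₂) / 4, by omega⟩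
    obtain ⟨k₃, hk₃⟩ : ∃ k₃, r₃ + 4 * k₃ = 0 := ⟨-r₃ / 4, by omega⟩
    refine fin k₂ k₃ (Or.inl ?_)
    rw [hk₂, hk₃]
    unfold circulantDet4
    linear_combination (9 * p₀ ^ 2 + 8 * p₁ ^ 2 + 9) * e₀ - (p₁ ^ 2 - 7) * e₁
  · obtain ⟨k₂, hk₂⟩ : ∃ k₂, r₂ + 4 * k₂ = 0 := ⟨-r₂ / 4, by omega⟩
    obtain ⟨k₃, hk₃⟩ : ∃ k₃, r₃ + 4 * k₃ = 2 * p₁ := ⟨(2 * p₁ - r₃) / 4, by omega⟩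
    refine fin k₂ k₃ (Or.inr ?_)
    rw [hk₂, hk₃]
    unfold circulantDet4
    linear_combination (p₀ ^ 2 - 8 * p₁ ^ 2 + 1) * e₀ - (9 * p₁ ^ 2 + 17) * e₁

theorem two_pow_eleven_mul_mem_of_mod_eight_eq_one {p : ℕ} {a b : ℤ} (hp : p.Prime)
    (hab : (p : ℤ) = a ^ 2 + b ^ 2) (h8 : (p : ℤ) ≡ 1 [ZMOD 8])
    (h3 : a + b ≡ 3 [ZMOD 8] ∨ a + b ≡ -3 [ZMOD 8]) (m : ℤ) :
    2 ^ 11 * (p : ℤ) * (2 * m + 1) ∈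
      integerGroupDeterminants (CyclicGroup 8 × CyclicGroup 2) := by
  simp only [Int.ModEq] at h8 h3
  obtain ⟨g₀, g₁, g₂, g₃, hg⟩ :=
    EighthCyclotomicInt.exists_cyclotomicNorm8_eq_prime hp (by omega)
  obtain ⟨h4, -⟩ := four_dvd_or_four_dvd_of_eq_sq_add_sq h8 hab
  rw [← hg]
  apply two_pow_eleven_mul_cyclotomicNorm8_mem
  -- the relative norm of `g` to `ℤ[i]` is one of the associates of `a ± b i`
  rcases hp.sq_add_sq_unique hab hg.symm with ⟨hx, hy⟩ | ⟨hx, hy⟩ <;>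
    rcases sq_eq_sq_iff_eq_or_eq_neg.mp hx with hx | hx <;>
    rcases sq_eq_sq_iff_eq_or_eq_neg.mp hy with hy | hy <;> rw [hx, hy] <;> omega

theorem two_pow_eleven_mul_sq_mem_of_mod_eight_eq_three {p : ℕ} (hp : p.Prime)
    (h8 : (p : ℤ) ≡ 3 [ZMOD 8]) (m : ℤ) :
    2 ^ 11 * (p : ℤ) ^ 2 * (2 * m + 1) ∈
      integerGroupDeterminants (CyclicGroup 8 × CyclicGroup 2) := by
  simp only [Int.ModEq] at h8
  obtain ⟨g₀, g₁, g₂, g₃, hg⟩ :=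
    EighthCyclotomicInt.exists_cyclotomicNorm8_eq_prime_sq hp (by omega)
  rw [← hg]
  apply two_pow_eleven_mul_cyclotomicNorm8_mem
  rw [cyclotomicNorm8] at hg
  obtain ⟨⟨x, hx⟩, ⟨y, hy⟩⟩ := hp.dvd_of_dvd_sq_add_sq (q := p) (by omega)
    ⟨(p : ℤ), by rw [hg]; ring⟩
  have hxy : x ^ 2 + y ^ 2 = 1 := by
    refine mul_left_cancel₀ (pow_ne_zero 2 (show (p : ℤ) ≠ 0 by exact_mod_cast hp.ne_zero)) ?_
    rw [hx, hy] at hg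
    linear_combination hg
  rw [hx, hy]
  have hx1 : -1 ≤ x ∧ x ≤ 1 := by constructor <;> nlinarith [sq_nonneg y]
  have hxc : x = -1 ∨ x = 0 ∨ x = 1 := by omega
  rcases hxc with rfl | rfl | rfl
  · have : y = 0 := by nlinarith
    subst this
    omega
  · have : y = 1 ∨ y = -1 := sq_eq_one_iff.mp (by linarith)
    rcases this with rfl | rfl <;> omega
  · have : y = 0 := by nlinarith
    subst this
    omega

theorem HasExceptionalPrime.exists_mul_eq {n : ℤ} (h : HasExceptionalPrime (2 * n)) (hn : Odd n) :
    (∃ (p : ℕ) (a b m : ℤ), p.Prime ∧ (p : ℤ) = a ^ 2 + b ^ 2 ∧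
        (p : ℤ) ≡ 1 [ZMOD 8] ∧ (a + b ≡ 3 [ZMOD 8] ∨ a + b ≡ -3 [ZMOD 8]) ∧
        n = (p : ℤ) * (2 * m + 1)) ∨
      (∃ (p : ℕ) (m : ℤ), p.Prime ∧ (p : ℤ) ≡ -3 [ZMOD 8] ∧ n = (p : ℤ) * (2 * m + 1)) ∨
      (∃ (p : ℕ) (m : ℤ), p.Prime ∧ (p : ℤ) ≡ 3 [ZMOD 8] ∧ n = (p : ℤ) ^ 2 * (2 * m + 1)) := by
  have key : ∀ d : ℤ, d % 2 = 1 → d ∣ 2 * n → ∃ m, n = d * (2 * m + 1) := by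
    intro d hd hdn
    have hc : IsCoprime d 2 := ⟨1, -(d / 2), by omega⟩
    obtain ⟨k, rfl⟩ := hc.dvd_of_dvd_mul_left hdn
    obtain ⟨m, rfl⟩ := (Int.odd_mul.mp hn).2
    exact ⟨m, rfl⟩
  obtain ⟨q, hq, ⟨a, b, h₁, h₂, h₃, h₄⟩ | ⟨h₁, h₂⟩ | ⟨h₁, h₂⟩⟩ := h
  · obtain ⟨m, hm⟩ := key _ (by simp only [Int.ModEq] at h₂; omega) h₄
    exact Or.inl ⟨q, a, b, m, hq, h₁, h₂, h₃, hm⟩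
  · obtain ⟨m, hm⟩ := key _ (by simp only [Int.ModEq] at h₁; omega) h₂
    exact Or.inr (Or.inl ⟨q, m, hq, h₁, hm⟩)
  · have hodd : ((q : ℤ) ^ 2) % 2 = 1 := by
      rw [← Int.odd_iff, Int.odd_pow' two_ne_zero, Int.odd_iff]
      simp only [Int.ModEq] at h₁
      omega
    obtain ⟨m, hm⟩ := key _ hodd h₂
    exact Or.inr (Or.inr ⟨q, m, hq, h₁, hm⟩)

/-! ### The set of values -/

theorem theorem1p5 :
    setA ⊂ {n : ℤ | ∃ m : ℤ, n = 16 * m - 7} ∧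
    integerGroupDeterminants (CyclicGroup 8 × CyclicGroup 2) =
      {n : ℤ | (∃ m : ℤ, n = 16 * m + 1) ∨ n ∈ setA ∨
        (∃ m : ℤ, n = 2 ^ 10 * (2 * m + 1)) ∨ (∃ m : ℤ, n = 2 ^ 12 * m)} ∪
      {n : ℤ | ∃ (p : ℕ) (a b m : ℤ), p.Prime ∧ (p : ℤ) = a ^ 2 + b ^ 2 ∧
        (p : ℤ) ≡ 1 [ZMOD 8] ∧ (a + b ≡ 3 [ZMOD 8] ∨ a + b ≡ -3 [ZMOD 8]) ∧
        n = 2 ^ 11 * (p : ℤ) * (2 * m + 1)} ∪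
      {n : ℤ | ∃ (p : ℕ) (m : ℤ), p.Prime ∧ (p : ℤ) ≡ -3 [ZMOD 8] ∧
        n = 2 ^ 11 * (p : ℤ) * (2 * m + 1)} ∪
      {n : ℤ | ∃ (p : ℕ) (m : ℤ), p.Prime ∧ (p : ℤ) ≡ 3 [ZMOD 8] ∧
        n = 2 ^ 11 * (p : ℤ) ^ 2 * (2 * m + 1)} := by
  refine ⟨setA_ssubset, Set.Subset.antisymm ?_ ?_⟩
  · intro n hn
    obtain ⟨u, v, h, rfl⟩ := (mem_integerGroupDeterminants_cyclicProd_iff n).mp hn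
    by_cases hodd : Odd (u 0 + u 4 + (u 2 + u 6) + (u 1 + u 5 + (u 3 + u 7)))
    · refine Or.inl (Or.inl (Or.inl ?_))
      rcases mul_modEq_one_or_mem_setA (odd_circulantDet8 hodd)
        (circulantDet8_modEq_of_odd h hodd) with h | h
      exacts [Or.inl h, Or.inr (Or.inl h)]
    · obtain ⟨n, hn, hcase⟩ := exists_mul_circulantDet8_eq_of_even h hodd
      rw [hn]
      have hfour : ∀ k : ℤ, n = 4 * k → ∃ m : ℤ, (2 : ℤ) ^ 10 * n = 2 ^ 12 * m :=
        fun k hk => ⟨k, by rw [hk]; ring⟩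
      rcases hcase with ⟨m, hm⟩ | ⟨k, hk⟩ | hexc
      · exact Or.inl (Or.inl (Or.inl (Or.inr (Or.inr (Or.inl ⟨m, by rw [hm]⟩)))))
      · exact Or.inl (Or.inl (Or.inl (Or.inr (Or.inr (Or.inr (hfour k hk))))))
      rcases Int.even_or_odd' n with ⟨k, rfl | rfl⟩
      · rcases Int.even_or_odd' k with ⟨l, rfl | hk⟩
        · exact Or.inl (Or.inl (Or.inl (Or.inr (Or.inr (Or.inr (hfour l (by ring)))))))
        · rcases hexc.exists_mul_eq ⟨l, hk⟩ with ⟨p, a, b, m, hp, h₁, h₂, h₃, hm⟩ |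
            ⟨p, m, hp, h₁, hm⟩ | ⟨p, m, hp, h₁, hm⟩
          · exact Or.inl (Or.inl (Or.inr ⟨p, a, b, m, hp, h₁, h₂, h₃, by rw [hm]; ring⟩))
          · exact Or.inl (Or.inr ⟨p, m, hp, h₁, by rw [hm]; ring⟩)
          · exact Or.inr ⟨p, m, hp, h₁, by rw [hm]; ring⟩
      · exact Or.inl (Or.inl (Or.inl (Or.inr (Or.inr (Or.inl ⟨k, rfl⟩)))))
  · rintro n (((h | ⟨p, a, b, m, hp, h₁, h₂, h₃, rfl⟩) | ⟨p, m, hp, h₁, rfl⟩) | ⟨p, m, hp, h₁, rfl⟩)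
    · rcases h with ⟨m, rfl⟩ | h | ⟨m, rfl⟩ | ⟨m, rfl⟩
      exacts [one_add_sixteen_mul_mem m, setA_subset h, two_pow_ten_mul_odd_mem m,
        two_pow_twelve_mul_mem m]
    · exact two_pow_eleven_mul_mem_of_mod_eight_eq_one hp h₁ h₂ h₃ m
    · exact two_pow_eleven_mul_mem_of_mod_eight_eq_five hp h₁ m
    · exact two_pow_eleven_mul_sq_mem_of_mod_eight_eq_three hp h₁ m
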